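/- **Setting.** Let $d,r$ be non-negative integers, $t_0<T$, $I=[t_0,T]$, and let $\varphi_0,\dots,\varphi_{r-1}:\mathbb R\to\mathbb R$ be $C^\infty$ and linearly independent on $I$. Put $$Y=\Big\{\sum_{i=0}^{r-1}W_i\varphi_i : W_i\in\mathbb R^d\Big\},\qquad X=\Big\{W+\sum_{i=0}^{r-1}W_i\int_{t_0}^{t}\varphi_i(s)\,ds : W,W_i\in\mathbb R^d\Big\},$$ and assume that $Y$ is invariant under translations and reflection: if $v\in Y$, then $t\mapsto v(t+c)$ (for every $c\in\mathbb R$) and $t\mapsto v(-t)$ belong to $Y$. For $h\ge 0$ let $X_h$, $Y_h$ be the spaces of functions $\tau\mapsto w(t_0+\tau h)$ on $[0,1]$ with $w\in X$, respectively $w\in Y$, and write $\tilde\varphi_i(\tau)=\varphi_i(t_0+\tau h)$, $\langle w_1,w_2\rangle=\int_0^1 w_1(\tau)\cdot w_2(\tau)\,d\tau$ (entrywise product). For $h>0$ put $M=(\langle\tilde\varphi_i,\tilde\varphi_j\rangle)_{i,j}$ and $$P_{\tau,\sigma}(h)=\sum_{i,j=0}^{r-1}\tilde\varphi_i(\tau)\,(M^{-1})_{ij}\,\tilde\varphi_j(\sigma),\qquad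 P_{\tau,\sigma}(0)=\lim_{h\to0^+}P_{\tau,\sigma}(h),\qquad A_{\tau,\sigma}(h)=\int_0^\tau P_{\alpha,\sigma}(h)\,d\alpha .$$ Let $f:\mathbb R^d\to\mathbb R^d$ be $C^\infty$ (for example $f=J^{-1}\nabla H$ with a smooth Hamiltonian $H$), $y_0\in\mathbb R^d$, $R>0$, let $\|\cdot\|$ be the maximum norm on $\mathbb R^d$ and the induced norms of multilinear maps, and put $B(y_0,R)=\{y:\|y-y_0\|\le R\}$, $$M_0=\max_{\tau,\sigma,h\in[0,1]}|A_{\tau,\sigma}(h)|,\qquad D_n=\max_{y\in B(y_0,R)}\|f^{(n)}(y)\|\quad(n=0,1).$$ **Theorem (existence, uniqueness and smoothness).** Suppose that $$\varepsilon<\min\Big\{\frac1{M_0D_1},\ \frac R{M_0D_0},\ 1\Big\},$$ a quotient with denominator $0$ being read as $+\infty$. Then for every $h$ with $0\le h\le\varepsilon$ there is exactly one function $u_h:[0,1]\to B(y_0,R)$ that solves the variational form of FFCFE$r$, $$u\in X_h,\qquad u(0)=y_0,\qquad \langle v,u'\rangle=h\,\langle v,f\circ u\rangle\quad\text{for all }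 v\in Y_h ,$$ and there is exactly one continuous function $[0,1]\to B(y_0,R)$ that solves its continuous-stage Runge–Kutta form $$u(\tau)=y_0+h\int_0^1A_{\tau,\sigma}(h)\,f(u(\sigma))\,d\sigma\qquad(\tau\in[0,1]);$$ the two solutions are the same function $u_h$. Moreover $u_h$ depends smoothly on $h$: the map $(h,\tau)\mapsto u_h(\tau)$ is $C^\infty$ on $[0,\varepsilon]\times[0,1]$. -/

import Mathlib

open Set Filter Topology MeasureTheory
open scoped ContDiff

noncomputable section

namespace FFCFE

/-- `span{ψ₀, ψ₁, …}` for scalar functions `ψ i` on `ℝ`, with coefficients in `ℝ^d`: the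
`ℝ^d`-valued functions `t ↦ ∑ i, ψ i t • W i`. -/
def vecSpan (d : ℕ) {n : ℕ} (ψ : Fin n → ℝ → ℝ) : Set (ℝ → Fin d → ℝ) :=
  {w | ∃ W : Fin n → Fin d → ℝ, ∀ t, w t = ∑ i, ψ i t • W i}

/-- The test space `Y = span{φ₀, …, φ_{r-1}}`. -/
def ySpace (d : ℕ) {r : ℕ} (φ : Fin r → ℝ → ℝ) : Set (ℝ → Fin d → ℝ) :=
  vecSpan d φ

/-- The trial space `X = span{1, ∫_{t₀}^t φ₀, …, ∫_{t₀}^t φ_{r-1}}`. -/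
def xSpace (d : ℕ) {r : ℕ} (φ : Fin r → ℝ → ℝ) (t₀ : ℝ) : Set (ℝ → Fin d → ℝ) :=
  vecSpan d (Fin.cons (fun _ => 1) (fun i t => ∫ s in t₀..t, φ i s) : Fin (r + 1) → ℝ → ℝ)

/-- Invariance of a space of functions on `ℝ` under all translations and under reflection. -/
def Invariant {d : ℕ} (Y : Set (ℝ → Fin d → ℝ)) : Prop :=
  (∀ v ∈ Y, ∀ c : ℝ, (fun t => v (t + c)) ∈ Y) ∧ ∀ v ∈ Y, (fun t => v (-t)) ∈ Y

/-- The space `S_h` of functions on `[0,1]` of the form `τ ↦ w (t₀ + τ h)` with `w ∈ S`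
(values outside `[0,1]` are irrelevant). -/
def rescaled {d : ℕ} (S : Set (ℝ → Fin d → ℝ)) (t₀ h : ℝ) : Set (ℝ → Fin d → ℝ) :=
  {v | ∃ w ∈ S, ∀ τ ∈ Icc (0 : ℝ) 1, v τ = w (t₀ + τ * h)}

/-- The matrix `M` of inner products over `[0,1]` of the functions `τ ↦ φ i (t₀ + τ h)`. -/
def gram {r : ℕ} (φ : Fin r → ℝ → ℝ) (t₀ h : ℝ) : Matrix (Fin r) (Fin r) ℝ :=
  Matrix.of fun i j => ∫ τ in (0 : ℝ)..1, φ i (t₀ + τ * h) * φ j (t₀ + τ * h)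

/-- The kernel of the orthogonal projection onto `Y_h`, by the explicit formula valid for
nonzero `h`. -/
def projFormula {r : ℕ} (φ : Fin r → ℝ → ℝ) (t₀ h τ σ : ℝ) : ℝ :=
  ∑ i, ∑ j, φ i (t₀ + τ * h) * (gram φ t₀ h)⁻¹ i j * φ j (t₀ + σ * h)

open Classical in
/-- The projection kernel `P_{τ,σ}(h)`, extended to `h = 0` by its limit as `h → 0`, `h > 0`. -/
def projKernel {r : ℕ} (φ : Fin r → ℝ → ℝ) (t₀ h τ σ : ℝ) : ℝ :=
  if h = 0 then limUnder (𝓝[>] (0 : ℝ)) (fun h' => projFormula φ t₀ h' τ σ)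
  else projFormula φ t₀ h τ σ

/-- The Runge–Kutta kernel `A_{τ,σ}(h) = ∫₀^τ P_{α,σ}(h) dα`. -/
def rkKernel {r : ℕ} (φ : Fin r → ℝ → ℝ) (t₀ h τ σ : ℝ) : ℝ :=
  ∫ α in (0 : ℝ)..τ, projKernel φ t₀ h α σ

/-- `M₀`: the maximum of `|A_{τ,σ}(h)|` over `τ, σ, h ∈ [0,1]`. -/
def kernelMax {r : ℕ} (φ : Fin r → ℝ → ℝ) (t₀ : ℝ) : ℝ :=
  sSup {x | ∃ h ∈ Icc (0 : ℝ) 1, ∃ τ ∈ Icc (0 : ℝ) 1, ∃ σ ∈ Icc (0 : ℝ) 1,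
    x = |rkKernel φ t₀ h τ σ|}

/-- `D_n`: the maximum of `‖f⁽ⁿ⁾(y)‖` over the closed ball `B(y₀,R)`. The norm on
`Fin d → ℝ` is the maximum norm and the norm of a multilinear map is the induced one. -/
def derivMax {d : ℕ} (f : (Fin d → ℝ) → Fin d → ℝ) (y₀ : Fin d → ℝ) (R : ℝ) (n : ℕ) : ℝ :=
  sSup ((fun y => ‖iteratedFDeriv ℝ n f y‖) '' Metric.closedBall y₀ R)

/-- `u`, as a function on `[0,1]`, solves the variational problem with step `h`:
`u ∈ X_h`, `u(0) = y₀` and `⟨v, u'⟩ = h ⟨v, f ∘ u⟩` for all `v ∈ Y_h`, where the inner product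
is the integral over `[0,1]` of the entrywise product. -/
def IsVariationalSolution {d r : ℕ} (φ : Fin r → ℝ → ℝ) (t₀ : ℝ)
    (f : (Fin d → ℝ) → Fin d → ℝ) (y₀ : Fin d → ℝ) (h : ℝ) (u : ℝ → Fin d → ℝ) : Prop :=
  u ∈ rescaled (xSpace d φ t₀) t₀ h ∧ u 0 = y₀ ∧
    ∀ v ∈ rescaled (ySpace d φ) t₀ h,
      ∫ τ in (0 : ℝ)..1, v τ * derivWithin u (Icc 0 1) τ
        = h • ∫ τ in (0 : ℝ)..1, v τ * f (u τ)

/-- `u`, as a continuous function on `[0,1]`, solves the continuous-stage Runge–Kutta equation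
`u(τ) = y₀ + h ∫₀¹ A_{τ,σ} f(u(σ)) dσ`. -/
def IsRKSolution {d r : ℕ} (φ : Fin r → ℝ → ℝ) (t₀ : ℝ)
    (f : (Fin d → ℝ) → Fin d → ℝ) (y₀ : Fin d → ℝ) (h : ℝ) (u : ℝ → Fin d → ℝ) : Prop :=
  ContinuousOn u (Icc 0 1) ∧
    ∀ τ ∈ Icc (0 : ℝ) 1, u τ = y₀ + h • ∫ σ in (0 : ℝ)..1, rkKernel φ t₀ h τ σ • f (u σ)

end FFCFE

end

/-! The difficulty is `h = 0`, where the functions `φ i (t₀ + τ h)` become constant in `τ` and their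
Gram matrix may degenerate. Translation invariance removes it: derivatives, as limits of difference
quotients, stay in the finite-dimensional span, so `Φ = (φ i)` solves `Φ' = B Φ` with a constant
matrix `B`. Linear independence and Cayley–Hamilton then give functionals `ℓ k`, `k < r`, such that
`ℓ k (Φ (t₀ + s)) = s ^ k * g k s` with `g k` smooth and `g k 0 ≠ 0`. Dividing by `h ^ k` leaves `χ
k (h, τ) = τ ^ k * g k (τ h)`, a basis of the rescaled span for `h ≠ 0` that is smooth in `h` and
still independent at `h = 0` (`exists_regular_basis`). A projection kernel does not depend on the
basis, so the Runge–Kutta kernel is a finite sum of products `X i (h, τ) * Z i (h, σ)` of smooth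
functions (`rkKernel_eq_of_basis`).

For such a kernel the integral equation is a fixed point equation for `r` vectors, the moments of `f
∘ u`. The bounds on `ε` make the integral operator a contraction of a ball in `C([0,1])`, which
gives existence and uniqueness. The same estimate makes the linearized moment equation injective,
hence invertible in finite dimension (`isInvertible_fderiv_moments`). The implicit function theorem
gives local smooth solutions, and uniqueness identifies them with the fixed points.

The variational form is equivalent to the integral form: the coefficients of `u'` solve a linear
system with the Gram matrix, which is invertible for `h ≠ 0`; at `h = 0` both forms say `u = y₀`. -/

/-! ### Parameter integrals, division by powers, Gram matrices -/

theorem hasFDerivAt_param_integral {E G : Type} [NormedAddCommGroup E] [NormedSpace ℝ E]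
    [NormedAddCommGroup G] [NormedSpace ℝ G] {F : E × ℝ → G}
    (hF : ContDiff ℝ 1 F) (x : E) :
    HasFDerivAt (fun x => ∫ θ in (0 : ℝ)..1, F (x, θ))
      (∫ θ in (0 : ℝ)..1, (fderiv ℝ F (x, θ)).comp (ContinuousLinearMap.inl ℝ E ℝ)) x := by
  have hF' : Continuous fun p : E × ℝ =>
      (fderiv ℝ F p).comp (ContinuousLinearMap.inl ℝ E ℝ) :=
    (hF.continuous_fderiv one_ne_zero).clm_comp continuous_const
  obtain ⟨C, hC⟩ := (isCompact_Icc (a := (0 : ℝ)) (b := 1)).exists_bound_of_continuousOn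
    (f := fun θ => (fderiv ℝ F (x, θ)).comp (ContinuousLinearMap.inl ℝ E ℝ))
    (by fun_prop)
  -- The strict bound `C + 1` is an open condition, so compactness of `[0,1]` makes it uniform for
  -- `y` near `x`; it serves as the dominating constant.
  have hnear : ∀ᶠ y in 𝓝 x, ∀ θ ∈ Icc (0 : ℝ) 1,
      ‖(fderiv ℝ F (y, θ)).comp (ContinuousLinearMap.inl ℝ E ℝ)‖ < C + 1 := by
    apply isCompact_Icc.eventually_forall_of_forall_eventually
    intro θ hθ
    have := hF'.norm.continuousAt (x := (x, θ))
    have h2 : ‖(fderiv ℝ F (x, θ)).comp (ContinuousLinearMap.inl ℝ E ℝ)‖ < C + 1 :=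
      (hC θ hθ).trans_lt (lt_add_one C)
    exact this.eventually (gt_mem_nhds h2)
  refine intervalIntegral.hasFDerivAt_integral_of_dominated_of_fderiv_le
    (F' := fun y θ => (fderiv ℝ F (y, θ)).comp (ContinuousLinearMap.inl ℝ E ℝ))
    (bound := fun _ => C + 1) hnear ?_ ?_ ?_ ?_ ?_ ?_
  · exact Eventually.of_forall fun y =>
      (hF.continuous.comp (by fun_prop : Continuous fun θ : ℝ => (y, θ))).aestronglyMeasurable
  · exact (hF.continuous.comp (by fun_prop : Continuous fun θ : ℝ => (x, θ))).intervalIntegrable _ _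
  · exact (hF'.comp (by fun_prop : Continuous fun θ : ℝ => (x, θ))).aestronglyMeasurable
  · refine Eventually.of_forall fun θ hθ y hy => (hy θ ?_).le
    rw [uIoc_of_le zero_le_one] at hθ
    exact ⟨hθ.1.le, hθ.2⟩
  · simp
  · refine Eventually.of_forall fun θ _ y _ => ?_
    exact ((hF.differentiable one_ne_zero (y, θ)).hasFDerivAt).comp y (hasFDerivAt_prodMk_left y θ)

/-- Each derivative is again a parameter integral, with values in a space of linear maps; hence the
induction quantifies over `E` and `G`. -/
theorem contDiff_nat_param_integral (n : ℕ) : ∀ {E G : Type} [NormedAddCommGroup E]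
    [NormedSpace ℝ E] [NormedAddCommGroup G] [NormedSpace ℝ G] {F : E × ℝ → G},
    ContDiff ℝ ∞ F → ContDiff ℝ n fun x => ∫ θ in (0 : ℝ)..1, F (x, θ) := by
  induction n with
  | zero =>
    intro E G _ _ _ _ F hF
    refine contDiff_zero.2 (continuous_iff_continuousAt.2 fun x => ?_)
    exact (hasFDerivAt_param_integral (hF.of_le (by simp)) x).continuousAt
  | succ n ih =>
    intro E G _ _ _ _ F hF
    push_cast
    rw [contDiff_succ_iff_hasFDerivAt]
    refine ⟨_, ?_, fun x => hasFDerivAt_param_integral (hF.of_le (by simp)) x⟩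
    exact ih (F := fun p => (fderiv ℝ F p).comp (ContinuousLinearMap.inl ℝ E ℝ))
      ((hF.fderiv_right (m := ∞) (by simp)).clm_comp contDiff_const)

theorem contDiff_param_integral {E G : Type} [NormedAddCommGroup E] [NormedSpace ℝ E]
    [NormedAddCommGroup G] [NormedSpace ℝ G] {F : E × ℝ → G} (hF : ContDiff ℝ ∞ F) :
    ContDiff ℝ ∞ fun x => ∫ θ in (0 : ℝ)..1, F (x, θ) :=
  contDiff_infty.2 fun n => contDiff_nat_param_integral n hF

/-- Hadamard's lemma, iterated: if `ψ' = s ^ k * g`, then `ψ s = s * ∫ ψ' (s θ) dθ` over `[0,1]`.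
The new factor is the integral of `θ ^ k * g (s θ)`, with value `g 0 / (k + 1)` at `0`. -/
theorem exists_eq_pow_mul_of_iteratedDeriv (k : ℕ) : ∀ {ψ : ℝ → ℝ}, ContDiff ℝ ∞ ψ →
    (∀ j < k, iteratedDeriv j ψ 0 = 0) → iteratedDeriv k ψ 0 ≠ 0 →
    ∃ g : ℝ → ℝ, ContDiff ℝ ∞ g ∧ g 0 ≠ 0 ∧ ∀ s, ψ s = s ^ k * g s := by
  induction k with
  | zero =>
    intro ψ hψ _ h0
    exact ⟨ψ, hψ, by simpa using h0, by simp⟩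
  | succ k ih =>
    intro ψ hψ hj hk
    have hψ' : ContDiff ℝ ∞ (deriv ψ) := (contDiff_infty_iff_deriv.1 hψ).2
    obtain ⟨g, hg, hg0, hgs⟩ := ih hψ'
      (fun j hjk => by rw [← iteratedDeriv_succ']; exact hj _ (by omega))
      (by rwa [← iteratedDeriv_succ'])
    refine ⟨fun s => ∫ θ in (0 : ℝ)..1, θ ^ k * g (s * θ), ?_, ?_, fun s => ?_⟩
    · exact contDiff_param_integral (F := fun p : ℝ × ℝ => p.2 ^ k * g (p.1 * p.2))
        (by fun_prop)
    · simp only [zero_mul, intervalIntegral.integral_mul_const, integral_pow]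
      simp only [one_pow, ne_eq, Nat.add_eq_zero_iff, one_ne_zero, and_false, not_false_eq_true,
        zero_pow, sub_zero, mul_eq_zero, hg0, or_false]
      positivity
    · have h0 : ψ 0 = 0 := by simpa using hj 0 (by omega)
      have h1 : ∫ x in (0 : ℝ)..s, deriv ψ x = ψ s - ψ 0 :=
        intervalIntegral.integral_deriv_eq_sub
          (fun x _ => hψ.differentiable (by simp) x) (hψ'.continuous.intervalIntegrable _ _)
      rw [h0, sub_zero] at h1
      have h2 := intervalIntegral.smul_integral_comp_mul_left (a := 0) (b := 1) (deriv ψ) s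
      rw [mul_zero, mul_one, h1] at h2
      rw [← h2, pow_succ', mul_assoc, ← intervalIntegral.integral_const_mul, smul_eq_mul]
      congr 2
      ext θ
      rw [hgs]
      ring

theorem contDiff_det {E : Type} [NormedAddCommGroup E] [NormedSpace ℝ E] {n : ℕ}
    {A : E → Matrix (Fin n) (Fin n) ℝ} (hA : ∀ i j, ContDiff ℝ ∞ fun x => A x i j) :
    ContDiff ℝ ∞ fun x => (A x).det := by
  simp only [Matrix.det_apply]
  exact ContDiff.sum fun σ _ => (contDiff_prod fun i _ => hA _ _).const_smul _

theorem contDiff_matrix_inv {E : Type} [NormedAddCommGroup E] [NormedSpace ℝ E] {n : ℕ}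
    {A : E → Matrix (Fin n) (Fin n) ℝ} (hA : ∀ i j, ContDiff ℝ ∞ fun x => A x i j)
    (hdet : ∀ x, (A x).det ≠ 0) (i j : Fin n) : ContDiff ℝ ∞ fun x => (A x)⁻¹ i j := by
  simp only [Matrix.inv_def, Ring.inverse_eq_inv', Matrix.smul_apply, smul_eq_mul,
    Matrix.adjugate_apply]
  refine ((contDiff_det hA).inv hdet).mul (contDiff_det fun k l => ?_)
  simp only [Matrix.updateRow_apply]
  split_ifs
  · exact contDiff_const
  · exact hA _ _

/-- The Gram matrix of linearly independent continuous functions is invertible. -/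
theorem det_gram_ne_zero {n : ℕ} {v : Fin n → ℝ → ℝ} (hv : ∀ i, Continuous (v i))
    (hind : ∀ c : Fin n → ℝ, (∀ τ ∈ Icc (0 : ℝ) 1, ∑ i, c i * v i τ = 0) → c = 0) :
    (Matrix.of fun i j => ∫ τ in (0 : ℝ)..1, v i τ * v j τ).det ≠ 0 := by
  intro hdet
  obtain ⟨c, hc, hc0⟩ := Matrix.exists_mulVec_eq_zero_iff.2 hdet
  apply hc
  apply hind
  have hcont : Continuous fun τ => ∑ i, c i * v i τ := by fun_prop
  -- The integral is the quadratic form of the Gram matrix at the null vector `c`.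
  have hint : ∫ τ in (0 : ℝ)..1, (∑ i, c i * v i τ) ^ 2 = 0 := by
    have h1 : ∀ τ, (∑ i, c i * v i τ) ^ 2 = ∑ i, ∑ j, c i * (c j * (v i τ * v j τ)) := by
      intro τ
      rw [sq, Finset.sum_mul_sum]
      exact Finset.sum_congr rfl fun i _ => Finset.sum_congr rfl fun j _ => by ring
    simp only [h1]
    rw [intervalIntegral.integral_finsetSum]
    · refine Finset.sum_eq_zero fun i _ => ?_
      rw [intervalIntegral.integral_finsetSum]
      · have h2 := congrFun hc0 i
        simp only [Matrix.mulVec, dotProduct, Matrix.of_apply, Pi.zero_apply] at h2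
        simp only [intervalIntegral.integral_const_mul]
        rw [← Finset.mul_sum]
        rw [Finset.sum_congr rfl fun j _ => mul_comm _ _, h2, mul_zero]
      · exact fun j _ => Continuous.intervalIntegrable (by fun_prop) _ _
    · exact fun j _ => Continuous.intervalIntegrable (by fun_prop) _ _
  by_contra hne
  push Not at hne
  obtain ⟨τ, hτ, hne⟩ := hne
  have := intervalIntegral.integral_pos (f := fun τ => (∑ i, c i * v i τ) ^ 2) zero_lt_one
    (hcont.pow 2).continuousOn (fun x _ => sq_nonneg _) ⟨τ, hτ, by positivity⟩
  exact this.ne' hint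

/-! ### Linear functionals along solutions of `Φ' = B Φ` -/

section LinearODE

variable {E : Type} [NormedAddCommGroup E] [NormedSpace ℝ E] {B : E →L[ℝ] E} {Φ : ℝ → E}

theorem eq_exp_apply_of_hasDerivAt [CompleteSpace E] (hΦ : ∀ t, HasDerivAt Φ (B (Φ t)) t)
    (t₁ t : ℝ) : Φ t = NormedSpace.exp ((t - t₁) • B) (Φ t₁) := by
  have h2 : ∀ t, HasDerivAt (fun t => NormedSpace.exp ((t - t₁) • B) (Φ t₁))
      (B (NormedSpace.exp ((t - t₁) • B) (Φ t₁))) t := by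
    intro t
    have := (hasDerivAt_exp_smul_const' B (t - t₁)).comp_sub_const t t₁
    have h3 := this.clm_apply (hasDerivAt_const t (Φ t₁))
    simpa using h3
  refine congrFun (ODE_solution_unique_univ (v := fun _ x => B x) (s := fun _ => univ)
    (t₀ := t₁) (K := ‖B‖₊)
    (fun _ => B.lipschitz.lipschitzOnWith) (fun t => ⟨hΦ t, mem_univ _⟩)
    (fun t => ⟨h2 t, mem_univ _⟩) (by simp)) t

/-- The numbers `ℓ (B ^ k (Φ t₁))` are the Taylor coefficients of `ℓ ∘ Φ` at `t₁`, up to factorials,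
and the exponential series converges everywhere. -/
theorem functional_eq_zero_of_pow [CompleteSpace E] (hΦ : ∀ t, HasDerivAt Φ (B (Φ t)) t)
    (ℓ : E →L[ℝ] ℝ) (t₁ : ℝ) (h : ∀ k : ℕ, ℓ ((B ^ k) (Φ t₁)) = 0) (t : ℝ) : ℓ (Φ t) = 0 := by
  rw [eq_exp_apply_of_hasDerivAt hΦ t₁ t]
  have h1 := NormedSpace.exp_series_hasSum_exp' (𝕂 := ℝ) ((t - t₁) • B)
  have h2 := (h1.mapL (ContinuousLinearMap.apply ℝ E (Φ t₁))).mapL ℓ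
  refine h2.unique ?_
  convert hasSum_zero with n
  simp only [smul_pow, map_smul, ContinuousLinearMap.apply_apply, h n, smul_zero]

theorem iteratedDeriv_functional (hΦ : ∀ t, HasDerivAt Φ (B (Φ t)) t) (ℓ : E →L[ℝ] ℝ) (k : ℕ) :
    iteratedDeriv k (fun t => ℓ (Φ t)) = fun t => ℓ ((B ^ k) (Φ t)) := by
  induction k with
  | zero => simp
  | succ k ih =>
    rw [iteratedDeriv_succ, ih]
    ext t
    have := ((ℓ ∘L (B ^ k)).hasFDerivAt.comp_hasDerivAt t (hΦ t)).deriv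
    rw [pow_succ]
    exact this

theorem functional_eq_zero_of_eqOn_Ioo [CompleteSpace E] (hΦ : ∀ t, HasDerivAt Φ (B (Φ t)) t)
    (ℓ : E →L[ℝ] ℝ) {a b : ℝ} (hab : a < b) (h : ∀ t ∈ Ioo a b, ℓ (Φ t) = 0) (t : ℝ) :
    ℓ (Φ t) = 0 := by
  obtain ⟨t₁, ht₁⟩ := nonempty_Ioo.2 hab
  refine functional_eq_zero_of_pow hΦ ℓ t₁ (fun k => ?_) t
  have h0 : (fun t => ℓ (Φ t)) =ᶠ[𝓝 t₁] fun _ => 0 := by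
    filter_upwards [isOpen_Ioo.mem_nhds ht₁] with s hs using h s hs
  have h1 := (h0.iteratedDeriv k).eq_of_nhds
  rw [iteratedDeriv_functional hΦ] at h1
  simpa using h1

/-- Cayley–Hamilton: modulo the characteristic polynomial every power of `B` is a combination of
powers below the dimension. -/
theorem functional_pow_eq_zero [FiniteDimensional ℝ E] (ℓ : E →L[ℝ] ℝ) (v : E)
    (h : ∀ k < Module.finrank ℝ E, ℓ ((B ^ k) v) = 0) (k : ℕ) : ℓ ((B ^ k) v) = 0 := by
  have hpow : ∀ k : ℕ, (B ^ k) v = ((B : E →ₗ[ℝ] E) ^ k) v := by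
    intro k
    rw [← ContinuousLinearMap.toLinearMap_pow]; rfl
  rcases Nat.eq_zero_or_pos (Module.finrank ℝ E) with h0 | h0
  · have := Module.finrank_zero_iff.1 h0
    rw [Subsingleton.elim ((B ^ k) v) 0, map_zero]
  · rw [hpow, LinearMap.pow_eq_aeval_mod_charpoly]
    have hdeg := Polynomial.natDegree_modByMonic_lt (Polynomial.X ^ k)
      (LinearMap.charpoly_monic (B : E →ₗ[ℝ] E)) (by
        intro h1
        have := LinearMap.charpoly_natDegree (B : E →ₗ[ℝ] E)
        rw [h1, Polynomial.natDegree_one] at this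
        omega)
    rw [LinearMap.charpoly_natDegree] at hdeg
    rw [Polynomial.aeval_eq_sum_range' hdeg, LinearMap.sum_apply, map_sum]
    refine Finset.sum_eq_zero fun j hj => ?_
    rw [LinearMap.smul_apply, map_smul, ← hpow, h j (Finset.mem_range.1 hj), smul_zero]

end LinearODE

/-! ### A basis of the rescaled span that is regular at `h = 0` -/

section TranslationInvariant

variable {r : ℕ} {φ : Fin r → ℝ → ℝ}

theorem FFCFE.Invariant.exists_translate {d : ℕ} (hd : 0 < d)
    (hinv : FFCFE.Invariant (FFCFE.ySpace d φ)) (i : Fin r) (c : ℝ) :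
    ∃ a : Fin r → ℝ, ∀ t, φ i (t + c) = ∑ j, a j * φ j t := by
  obtain ⟨W, hW⟩ := hinv.1 (fun t => φ i t • (1 : Fin d → ℝ)) ⟨Pi.single i 1, fun t => by
    simp [Pi.single_apply]⟩ c
  refine ⟨fun j => W j ⟨0, hd⟩, fun t => ?_⟩
  have := congrFun (hW t) ⟨0, hd⟩
  simpa [mul_comm] using this

/-- Any point can be translated to an interior point `m` of `[t₀, T]`, where smoothness is given. -/
theorem contDiff_of_translate {t₀ T : ℝ} (hT : t₀ < T)
    (hsm : ∀ i, ContDiffOn ℝ ∞ (φ i) (Icc t₀ T))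
    (htr : ∀ i c, ∃ a : Fin r → ℝ, ∀ t, φ i (t + c) = ∑ j, a j * φ j t) (i : Fin r) :
    ContDiff ℝ ∞ (φ i) := by
  refine contDiff_iff_contDiffAt.2 fun t => ?_
  obtain ⟨m, hm⟩ := nonempty_Ioo.2 hT
  obtain ⟨a, ha⟩ := htr i (t - m)
  have h1 : φ i = fun s => ∑ j, a j * φ j (s - (t - m)) := by
    ext s
    rw [← ha, sub_add_cancel]
  rw [h1]
  refine ContDiffAt.sum fun j _ => contDiffAt_const.mul ?_
  have h2 : ContDiffAt ℝ ∞ (φ j) (t - (t - m)) := by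
    rw [sub_sub_cancel]
    exact (hsm j).contDiffAt (Icc_mem_nhds hm.1 hm.2)
  exact h2.comp t (by fun_prop)

theorem exists_deriv_of_translate (hsm : ∀ i, ContDiff ℝ ∞ (φ i))
    (htr : ∀ i c, ∃ a : Fin r → ℝ, ∀ t, φ i (t + c) = ∑ j, a j * φ j t) (i : Fin r) :
    ∃ b : Fin r → ℝ, ∀ t, deriv (φ i) t = ∑ j, b j * φ j t := by
  set S : Submodule ℝ (ℝ → ℝ) := Submodule.span ℝ (range φ)
  have : FiniteDimensional ℝ S := FiniteDimensional.span_of_finite ℝ (finite_range φ)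
  have hlim : Tendsto (fun c => fun t => c⁻¹ • (φ i (t + c) - φ i t)) (𝓝[≠] (0 : ℝ))
      (𝓝 (deriv (φ i))) :=
    tendsto_pi_nhds.2 fun t =>
      ((hsm i).differentiable (by simp) t).hasDerivAt.tendsto_slope_zero
  have hmem : deriv (φ i) ∈ S := by
    -- The difference quotients lie in `S`, which is closed under pointwise limits because it is
    -- finite-dimensional.
    refine S.closed_of_finiteDimensional.mem_of_tendsto hlim (Eventually.of_forall fun c => ?_)
    obtain ⟨a, ha⟩ := htr i c
    have : (fun t => c⁻¹ • (φ i (t + c) - φ i t)) = c⁻¹ • ((∑ j, a j • φ j) - φ i) := by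
      ext t
      simp [ha]
    rw [this]
    exact S.smul_mem _ (S.sub_mem (S.sum_mem fun j _ => S.smul_mem _
      (Submodule.subset_span (mem_range_self j))) (Submodule.subset_span (mem_range_self i)))
  obtain ⟨b, hb⟩ := (Submodule.mem_span_range_iff_exists_fun ℝ).1 hmem
  refine ⟨b, fun t => ?_⟩
  rw [← hb]
  simp

/-- The functions `φ i` are the coordinates of a curve that solves a linear differential equation
with constant coefficients. -/
theorem exists_linearODE (hsm : ∀ i, ContDiff ℝ ∞ (φ i))
    (htr : ∀ i c, ∃ a : Fin r → ℝ, ∀ t, φ i (t + c) = ∑ j, a j * φ j t) :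
    ∃ B : (Fin r → ℝ) →L[ℝ] (Fin r → ℝ), ∀ t,
      HasDerivAt (fun t i => φ i t) (B fun i => φ i t) t := by
  choose b hb using exists_deriv_of_translate hsm htr
  refine ⟨LinearMap.toContinuousLinearMap (Matrix.toLin' (Matrix.of b)), fun t => ?_⟩
  refine hasDerivAt_pi.2 fun i => ?_
  have := ((hsm i).differentiable (by simp) t).hasDerivAt
  rw [hb] at this
  simpa [Matrix.mulVec, dotProduct] using this

theorem coeff_eq_zero_of_pow {c : Fin r → ℝ}
    (h : ∀ τ ∈ Icc (0 : ℝ) 1, ∑ k, c k * τ ^ (k : ℕ) = 0) : c = 0 := by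
  set p : Polynomial ℝ := ∑ k : Fin r, Polynomial.monomial (k : ℕ) (c k)
  have hp : p = 0 := by
    refine Polynomial.eq_zero_of_infinite_isRoot p ((Icc_infinite zero_lt_one).mono fun τ hτ => ?_)
    simp only [p, mem_ofPred_eq, Polynomial.IsRoot.def, Polynomial.eval_finsetSum,
      Polynomial.eval_monomial]
    exact h τ hτ
  ext i
  have := congrArg (fun q => Polynomial.coeff q i) hp
  simpa [p, Polynomial.coeff_monomial, Fin.val_inj] using this

/-- On the intervals `[t₀, t₀ + h]`, rescaled to `[0,1]`, the span of the `φ i` has a basis that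
depends smoothly on `h` and remains a basis at `h = 0`. -/
theorem exists_regular_basis {t₀ T : ℝ} (hsm : ∀ i, ContDiff ℝ ∞ (φ i))
    (htr : ∀ i c, ∃ a : Fin r → ℝ, ∀ t, φ i (t + c) = ∑ j, a j * φ j t)
    (hind : LinearIndependent ℝ (fun (i : Fin r) (t : Icc t₀ T) => φ i t)) :
    (∀ h ≠ 0, ∀ c : Fin r → ℝ,
      (∀ τ ∈ Icc (0 : ℝ) 1, ∑ i, c i * φ i (t₀ + τ * h) = 0) → c = 0) ∧
    ∃ χ : Fin r → ℝ × ℝ → ℝ, (∀ k, ContDiff ℝ ∞ (χ k)) ∧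
      (∀ h (c : Fin r → ℝ), (∀ τ ∈ Icc (0 : ℝ) 1, ∑ k, c k * χ k (h, τ) = 0) → c = 0) ∧
      ∀ h, ∃ C : Matrix (Fin r) (Fin r) ℝ, ∀ i τ,
        φ i (t₀ + τ * h) = ∑ k, C i k * χ k (h, τ) := by
  obtain ⟨B, hB⟩ := exists_linearODE hsm htr
  set Φ : ℝ → Fin r → ℝ := fun t i => φ i t
  have hℓ : ∀ ℓ : (Fin r → ℝ) →L[ℝ] ℝ, (∀ t, ℓ (Φ t) = 0) → ℓ = 0 := by
    intro ℓ h0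
    have hsum : ∀ x, ℓ x = ∑ i, ℓ (Pi.single i 1) * x i := by
      intro x
      conv_lhs => rw [← Finset.univ_sum_single x, map_sum]
      refine Finset.sum_congr rfl fun i _ => ?_
      rw [mul_comm, ← smul_eq_mul, ← map_smul, ← Pi.single_smul, smul_eq_mul, mul_one]
    have h1 := Fintype.linearIndependent_iff.1 hind (fun i => ℓ (Pi.single i 1)) (by
      ext t
      have := h0 t
      rw [hsum] at this
      simpa using this)
    ext x
    rw [hsum]
    simp [h1]
  have hne : ∀ h ≠ 0, ∀ ℓ : (Fin r → ℝ) →L[ℝ] ℝ,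
      (∀ τ ∈ Icc (0 : ℝ) 1, ℓ (Φ (t₀ + τ * h)) = 0) → ℓ = 0 := by
    intro h hh ℓ h0
    have key : ∀ s ∈ uIcc t₀ (t₀ + h), ℓ (Φ s) = 0 := by
      intro s hs
      have h1 := h0 ((s - t₀) / h) (by
        rcases lt_or_gt_of_ne hh with hneg | hpos
        · rw [uIcc_of_ge (by linarith)] at hs
          exact ⟨div_nonneg_of_nonpos (by linarith [hs.2]) hneg.le,
            (div_le_one_of_neg hneg).2 (by linarith [hs.1])⟩
        · rw [uIcc_of_le (by linarith)] at hs
          exact ⟨div_nonneg (by linarith [hs.1]) hpos.le,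
            (div_le_one hpos).2 (by linarith [hs.2])⟩)
      rwa [div_mul_cancel₀ _ hh, add_sub_cancel] at h1
    refine hℓ ℓ (functional_eq_zero_of_eqOn_Ioo hB ℓ (inf_lt_sup.2 (by simpa using hh))
      fun t ht => key t (Ioo_subset_Icc_self ht))
  -- `L ℓ` lists the derivatives of `ℓ ∘ Φ` at `t₀` of orders `0, …, r - 1`. They determine `ℓ`, so
  -- `L` is bijective by dimension, and the preimages of the unit vectors give functions vanishing
  -- to order exactly `k`.
  set L : ((Fin r → ℝ) →L[ℝ] ℝ) →ₗ[ℝ] (Fin r → ℝ) :=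
    { toFun := fun ℓ k => ℓ ((B ^ (k : ℕ)) (Φ t₀))
      map_add' := fun _ _ => rfl
      map_smul' := fun _ _ => rfl }
  have hLi : Function.Injective L := by
    refine (injective_iff_map_eq_zero L).2 fun ℓ h0 => hℓ ℓ ?_
    refine functional_eq_zero_of_pow hB ℓ t₀ (functional_pow_eq_zero ℓ (Φ t₀) fun k hk => ?_)
    rw [Module.finrank_fin_fun] at hk
    exact congrFun h0 ⟨k, hk⟩
  have hLs : Function.Surjective L := by
    refine (LinearMap.injective_iff_surjective_of_finrank_eq_finrank ?_).1 hLi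
    rw [← (LinearMap.toContinuousLinearMap (𝕜 := ℝ) (E := Fin r → ℝ) (F' := ℝ)).finrank_eq]
    exact Subspace.dual_finrank_eq
  choose ℓ hℓL using fun k : Fin r => hLs (Pi.single k 1)
  have hℓk : ∀ k j : Fin r, ℓ k ((B ^ (j : ℕ)) (Φ t₀)) = if j = k then 1 else 0 := by
    intro k j
    have := congrFun (hℓL k) j
    rwa [Pi.single_apply] at this
  have hΦs : ContDiff ℝ ∞ fun s => Φ (t₀ + s) :=
    contDiff_pi.2 fun i => (hsm i).comp (by fun_prop)
  have hB' : ∀ s, HasDerivAt (fun s => Φ (t₀ + s)) (B (Φ (t₀ + s))) s :=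
    fun s => (hB (t₀ + s)).comp_const_add t₀ s
  have hg : ∀ k : Fin r, ∃ g : ℝ → ℝ, ContDiff ℝ ∞ g ∧ g 0 ≠ 0 ∧
      ∀ s, ℓ k (Φ (t₀ + s)) = s ^ (k : ℕ) * g s := by
    intro k
    apply exists_eq_pow_mul_of_iteratedDeriv
    · exact (ℓ k).contDiff.comp hΦs
    · intro j hj
      rw [iteratedDeriv_functional hB']
      have := hℓk k ⟨j, hj.trans k.2⟩
      simp only [Fin.ext_iff, hj.ne, if_false] at this
      simpa using this
    · rw [iteratedDeriv_functional hB']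
      have := hℓk k k
      simp only [if_true] at this
      simp only [add_zero, this]
      exact one_ne_zero
  choose g hgs hg0 hg using hg
  have hexp : ∀ (m : (Fin r → ℝ) →L[ℝ] ℝ), m = ∑ k, L m k • ℓ k := by
    intro m
    apply hLi
    ext j
    simp only [map_sum, map_smul, Finset.sum_apply, Pi.smul_apply, hℓL, Pi.single_apply,
      smul_eq_mul, mul_ite, mul_one, mul_zero, Finset.sum_ite_eq, Finset.mem_univ, if_true]
  -- For `h ≠ 0` this is `ℓ k (Φ (t₀ + τ h)) / h ^ k`; at `h = 0` it is the monomial `τ ^ k` times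
  -- `g k 0 ≠ 0`.
  refine ⟨fun h hh c hc => ?_, fun k p => p.2 ^ (k : ℕ) * g k (p.2 * p.1), fun k => ?_,
    fun h c hc => ?_, fun h => ?_⟩
  · have := hne h hh (∑ i, c i • ContinuousLinearMap.proj i) (by
      intro τ hτ
      simpa using hc τ hτ)
    ext i
    have := congrArg (fun m => m (Pi.single i 1)) this
    simpa [Pi.single_apply] using this
  · have := hgs k
    fun_prop
  · rcases eq_or_ne h 0 with rfl | hh
    · have := coeff_eq_zero_of_pow (c := fun k => c k * g k 0) (by
        intro τ hτ
        refine (Finset.sum_congr rfl fun k _ => ?_).trans (hc τ hτ)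
        simp only [mul_zero]
        ring)
      ext k
      exact (mul_eq_zero.1 (congrFun this k)).resolve_right (hg0 k)
    · have h1 := hne h hh (∑ k, (c k * (h ^ (k : ℕ))⁻¹) • ℓ k) (by
        intro τ hτ
        rw [← hc τ hτ]
        simp only [sum_apply, smul_apply, hg, smul_eq_mul]
        refine Finset.sum_congr rfl fun k _ => ?_
        rw [mul_pow]
        field_simp)
      ext j
      have h2 := congrFun (congrArg L h1) j
      simp only [map_sum, map_smul, Finset.sum_apply, Pi.smul_apply, hℓL, Pi.single_apply,
        smul_eq_mul, mul_ite, mul_one, mul_zero, Finset.sum_ite_eq, Finset.mem_univ, if_true,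
        map_zero, Pi.zero_apply] at h2
      exact (mul_eq_zero.1 h2).resolve_right (inv_ne_zero (pow_ne_zero _ hh))
  · refine ⟨Matrix.of fun i k => L (ContinuousLinearMap.proj i) k * h ^ (k : ℕ), fun i τ => ?_⟩
    have h1 := congrArg (fun m => m (Φ (t₀ + τ * h))) (hexp (ContinuousLinearMap.proj i))
    simp only [ContinuousLinearMap.proj_apply, sum_apply,
      smul_apply, hg, smul_eq_mul] at h1
    change φ i (t₀ + τ * h) = _ at h1
    rw [h1]
    refine Finset.sum_congr rfl fun k _ => ?_
    rw [Matrix.of_apply, mul_pow]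
    ring

end TranslationInvariant

/-! ### The kernel in the regular basis -/

noncomputable section

variable {r : ℕ}

/-- Gram matrix over `[0,1]` of a family of functions of `τ` that depend on a parameter `h`. -/
def basisGram (χ : Fin r → ℝ × ℝ → ℝ) (h : ℝ) : Matrix (Fin r) (Fin r) ℝ :=
  Matrix.of fun i j => ∫ τ in (0 : ℝ)..1, χ i (h, τ) * χ j (h, τ)

/-- The dual basis, with respect to the inner product of `L²(0,1)`. -/
def dualBasis (χ : Fin r → ℝ × ℝ → ℝ) (i : Fin r) (p : ℝ × ℝ) : ℝ :=
  ∑ j, (basisGram χ p.1)⁻¹ i j * χ j p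

/-- The primitives in `τ` that vanish at `τ = 0`. -/
def basisPrimitive (χ : Fin r → ℝ × ℝ → ℝ) (i : Fin r) (p : ℝ × ℝ) : ℝ :=
  ∫ α in (0 : ℝ)..p.2, χ i (p.1, α)

variable {χ : Fin r → ℝ × ℝ → ℝ}

theorem det_basisGram_ne_zero (hχ : ∀ k, ContDiff ℝ ∞ (χ k))
    (hind : ∀ h (c : Fin r → ℝ), (∀ τ ∈ Icc (0 : ℝ) 1, ∑ k, c k * χ k (h, τ) = 0) → c = 0)
    (h : ℝ) : (basisGram χ h).det ≠ 0 :=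
  det_gram_ne_zero (v := fun i τ => χ i (h, τ))
    (fun i => (hχ i).continuous.comp (by fun_prop)) (hind h)

theorem contDiff_dualBasis (hχ : ∀ k, ContDiff ℝ ∞ (χ k))
    (hind : ∀ h (c : Fin r → ℝ), (∀ τ ∈ Icc (0 : ℝ) 1, ∑ k, c k * χ k (h, τ) = 0) → c = 0)
    (i : Fin r) : ContDiff ℝ ∞ (dualBasis χ i) := by
  refine ContDiff.sum fun j _ => ContDiff.mul ?_ (hχ j)
  refine (contDiff_matrix_inv (A := basisGram χ) (fun k l => ?_)
    (det_basisGram_ne_zero hχ hind) i j).comp contDiff_fst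
  exact contDiff_param_integral ((hχ k).mul (hχ l))

theorem contDiff_basisPrimitive (hχ : ∀ k, ContDiff ℝ ∞ (χ k)) (i : Fin r) :
    ContDiff ℝ ∞ (basisPrimitive χ i) := by
  -- Rescaling to a fixed interval of integration turns the primitive into a smooth parameter
  -- integral.
  have h1 : basisPrimitive χ i = fun p : ℝ × ℝ => p.2 * ∫ θ in (0 : ℝ)..1, χ i (p.1, p.2 * θ) := by
    ext p
    have := intervalIntegral.smul_integral_comp_mul_left (a := 0) (b := 1)
      (fun α => χ i (p.1, α)) p.2
    rw [mul_zero, mul_one, smul_eq_mul] at this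
    exact this.symm
  rw [h1]
  refine contDiff_snd.mul (contDiff_param_integral
    (F := fun q : (ℝ × ℝ) × ℝ => χ i (q.1.1, q.1.2 * q.2)) ?_)
  exact (hχ i).comp (by fun_prop)

variable {φ : Fin r → ℝ → ℝ} {t₀ : ℝ}

/-- Under a change of basis `C` the Gram matrix becomes `C G Cᵀ`, and the factors cancel against
those of the basis vectors. Invertibility of `C` follows from `hdet`. -/
theorem projFormula_eq_of_basis {h : ℝ} (hχ : ∀ k, ContDiff ℝ ∞ (χ k))
    (hdet : (FFCFE.gram φ t₀ h).det ≠ 0)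
    {C : Matrix (Fin r) (Fin r) ℝ} (hC : ∀ i τ, φ i (t₀ + τ * h) = ∑ k, C i k * χ k (h, τ))
    (τ σ : ℝ) :
    FFCFE.projFormula φ t₀ h τ σ = ∑ i, χ i (h, τ) * dualBasis χ i (h, σ) := by
  have hcont : ∀ k, Continuous fun τ => χ k (h, τ) :=
    fun k => (hχ k).continuous.comp (by fun_prop)
  have hgram : FFCFE.gram φ t₀ h = C * basisGram χ h * C.transpose := by
    ext i j
    simp only [FFCFE.gram, Matrix.of_apply, Matrix.mul_apply, Matrix.transpose_apply, hC,
      basisGram]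
    have h1 : ∀ τ, (∑ k, C i k * χ k (h, τ)) * (∑ k, C j k * χ k (h, τ)) =
        ∑ l, ∑ k, C i k * (χ k (h, τ) * χ l (h, τ)) * C j l := by
      intro τ
      rw [mul_comm, Finset.sum_mul_sum]
      exact Finset.sum_congr rfl fun _ _ => Finset.sum_congr rfl fun _ _ => by ring
    simp only [h1]
    rw [intervalIntegral.integral_finsetSum
      fun l _ => Continuous.intervalIntegrable (by fun_prop) _ _]
    refine Finset.sum_congr rfl fun l _ => ?_
    rw [intervalIntegral.integral_finsetSum
      fun k _ => Continuous.intervalIntegrable (by fun_prop) _ _, Finset.sum_mul]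
    simp only [intervalIntegral.integral_mul_const, intervalIntegral.integral_const_mul]
  have hCdet : IsUnit C.det := by
    rw [hgram, Matrix.det_mul, Matrix.det_mul, Matrix.det_transpose] at hdet
    exact isUnit_iff_ne_zero.2 (right_ne_zero_of_mul hdet)
  have h1 : FFCFE.projFormula φ t₀ h τ σ =
      (C.mulVec fun k => χ k (h, τ)) ⬝ᵥ
        ((FFCFE.gram φ t₀ h)⁻¹.mulVec (C.mulVec fun k => χ k (h, σ))) := by
    simp only [FFCFE.projFormula, dotProduct, Matrix.mulVec, hC, Finset.mul_sum, mul_assoc]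
  have h2 : ∑ i, χ i (h, τ) * dualBasis χ i (h, σ) =
      (fun k => χ k (h, τ)) ⬝ᵥ ((basisGram χ h)⁻¹.mulVec fun k => χ k (h, σ)) := rfl
  rw [h1, h2, hgram, Matrix.mul_inv_rev, Matrix.mul_inv_rev, Matrix.mulVec_mulVec,
    Matrix.mul_assoc, Matrix.mul_assoc, Matrix.nonsing_inv_mul _ hCdet, Matrix.mul_one,
    ← Matrix.mulVec_mulVec, Matrix.dotProduct_mulVec, ← Matrix.mulVec_transpose,
    Matrix.mulVec_mulVec, Matrix.transpose_nonsing_inv, Matrix.transpose_transpose,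
    Matrix.nonsing_inv_mul _ hCdet, Matrix.one_mulVec]

/-- The right-hand side is continuous in `h`, so its value at `0` is the limit that defines the
kernel there. -/
theorem projKernel_eq_of_basis (hχ : ∀ k, ContDiff ℝ ∞ (χ k))
    (hind : ∀ h (c : Fin r → ℝ), (∀ τ ∈ Icc (0 : ℝ) 1, ∑ k, c k * χ k (h, τ) = 0) → c = 0)
    (hdet : ∀ h ≠ 0, (FFCFE.gram φ t₀ h).det ≠ 0)
    (hC : ∀ h, ∃ C : Matrix (Fin r) (Fin r) ℝ, ∀ i τ,
        φ i (t₀ + τ * h) = ∑ k, C i k * χ k (h, τ)) (h τ σ : ℝ) :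
    FFCFE.projKernel φ t₀ h τ σ = ∑ i, χ i (h, τ) * dualBasis χ i (h, σ) := by
  have hne : ∀ h ≠ 0,
      FFCFE.projFormula φ t₀ h τ σ = ∑ i, χ i (h, τ) * dualBasis χ i (h, σ) := by
    intro h hh
    obtain ⟨C, hC⟩ := hC h
    exact projFormula_eq_of_basis hχ (hdet h hh) hC τ σ
  unfold FFCFE.projKernel
  split_ifs with h0
  · subst h0
    apply Tendsto.limUnder_eq
    have hcont : Continuous fun h => ∑ i, χ i (h, τ) * dualBasis χ i (h, σ) :=
      continuous_finsetSum _ fun i _ => ((hχ i).continuous.comp (by fun_prop)).mul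
        ((contDiff_dualBasis hχ hind i).continuous.comp (by fun_prop))
    refine (hcont.continuousAt.tendsto.mono_left nhdsWithin_le_nhds).congr' ?_
    filter_upwards [self_mem_nhdsWithin] with h hh
    exact (hne h (ne_of_gt hh)).symm
  · exact hne h h0

theorem rkKernel_eq_of_basis (hχ : ∀ k, ContDiff ℝ ∞ (χ k))
    (hind : ∀ h (c : Fin r → ℝ), (∀ τ ∈ Icc (0 : ℝ) 1, ∑ k, c k * χ k (h, τ) = 0) → c = 0)
    (hdet : ∀ h ≠ 0, (FFCFE.gram φ t₀ h).det ≠ 0)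
    (hC : ∀ h, ∃ C : Matrix (Fin r) (Fin r) ℝ, ∀ i τ,
        φ i (t₀ + τ * h) = ∑ k, C i k * χ k (h, τ)) (h τ σ : ℝ) :
    FFCFE.rkKernel φ t₀ h τ σ = ∑ i, basisPrimitive χ i (h, τ) * dualBasis χ i (h, σ) := by
  unfold FFCFE.rkKernel
  simp only [projKernel_eq_of_basis hχ hind hdet hC]
  rw [intervalIntegral.integral_finsetSum]
  · simp only [intervalIntegral.integral_mul_const, basisPrimitive]
  · intro i _
    have : Continuous fun τ => χ i (h, τ) := (hχ i).continuous.comp (by fun_prop)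
    exact Continuous.intervalIntegrable (by fun_prop) _ _

/-- For `h ≠ 0` the kernel is given by the original functions. -/
theorem rkKernel_eq_of_ne_zero (hφ : ∀ i, ContDiff ℝ ∞ (φ i)) {h : ℝ} (hh : h ≠ 0) (τ σ : ℝ) :
    FFCFE.rkKernel φ t₀ h τ σ = ∑ i, (∫ α in (0 : ℝ)..τ, φ i (t₀ + α * h)) *
      ∑ j, (FFCFE.gram φ t₀ h)⁻¹ i j * φ j (t₀ + σ * h) := by
  have hc : ∀ i, Continuous (φ i) := fun i => (hφ i).continuous
  simp only [FFCFE.rkKernel, FFCFE.projKernel, if_neg hh, FFCFE.projFormula, mul_assoc,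
    ← Finset.mul_sum]
  rw [intervalIntegral.integral_finsetSum]
  · simp only [intervalIntegral.integral_mul_const]
  · exact fun i _ => Continuous.intervalIntegrable (by fun_prop) _ _

end

/-! ### Integral equations with a separable kernel -/

theorem eqOn_zero_of_contraction {G : Type} [NormedAddCommGroup G] {w : ℝ → G}
    (hw : ContinuousOn w (Icc 0 1)) {κ : ℝ} (hκ : κ < 1)
    (hcon : ∀ δ, (∀ σ ∈ Icc (0 : ℝ) 1, ‖w σ‖ ≤ δ) → ∀ τ ∈ Icc (0 : ℝ) 1, ‖w τ‖ ≤ κ * δ) :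
    ∀ τ ∈ Icc (0 : ℝ) 1, w τ = 0 := by
  obtain ⟨m, hm, hmax⟩ := isCompact_Icc.exists_isMaxOn (nonempty_Icc.2 zero_le_one) hw.norm
  have h1 : ∀ σ ∈ Icc (0 : ℝ) 1, ‖w σ‖ ≤ ‖w m‖ := fun σ hσ => hmax hσ
  have h2 := hcon _ h1 m hm
  have h3 : ‖w m‖ ≤ 0 := by nlinarith [norm_nonneg (w m)]
  exact fun τ hτ => norm_le_zero_iff.1 ((h1 τ hτ).trans h3)

theorem isInvertible_of_injective {E : Type} [NormedAddCommGroup E] [NormedSpace ℝ E]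
    [FiniteDimensional ℝ E] (L : E →L[ℝ] E) (hL : ∀ v, L v = 0 → v = 0) : L.IsInvertible :=
  ⟨(LinearEquiv.ofInjectiveEndo (L : E →ₗ[ℝ] E)
    ((injective_iff_map_eq_zero L).2 hL)).toContinuousLinearEquiv, by ext; rfl⟩

noncomputable section

variable {r : ℕ} {V : Type} [NormedAddCommGroup V] [NormedSpace ℝ V]

/-- The curve `τ ↦ y₀ + h ∑ i, X i (h, τ) a i`. -/
def stageCurve (X : Fin r → ℝ × ℝ → ℝ) (y₀ : V) (h : ℝ) (a : Fin r → V) (τ : ℝ) : V :=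
  y₀ + h • ∑ i, X i (h, τ) • a i

/-- The moments of `f ∘ u` against the functions `Z i (h, ·)`. -/
def moments (Z : Fin r → ℝ × ℝ → ℝ) (f : V → V) (h : ℝ) (u : ℝ → V) (i : Fin r) : V :=
  ∫ σ in (0 : ℝ)..1, Z i (h, σ) • f (u σ)

variable {X Z : Fin r → ℝ × ℝ → ℝ} {y₀ : V} {f : V → V}

theorem contDiff_stageCurve {E : Type} [NormedAddCommGroup E] [NormedSpace ℝ E]
    (hX : ∀ i, ContDiff ℝ ∞ (X i)) {h τ : E → ℝ} {a : E → Fin r → V}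
    (hh : ContDiff ℝ ∞ h) (ha : ContDiff ℝ ∞ a) (hτ : ContDiff ℝ ∞ τ) :
    ContDiff ℝ ∞ fun p => stageCurve X y₀ (h p) (a p) (τ p) :=
  contDiff_const.add (hh.smul (ContDiff.sum fun i _ =>
    ((hX i).comp (hh.prodMk hτ)).smul (contDiff_pi.1 ha i)))

theorem continuous_stageCurve (hX : ∀ i, ContDiff ℝ ∞ (X i)) (h : ℝ) (a : Fin r → V) :
    Continuous (stageCurve X y₀ h a) :=
  (contDiff_stageCurve (τ := id) hX contDiff_const contDiff_const contDiff_id).continuous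

theorem contDiff_moments (hX : ∀ i, ContDiff ℝ ∞ (X i)) (hZ : ∀ i, ContDiff ℝ ∞ (Z i))
    (hf : ContDiff ℝ ∞ f) :
    ContDiff ℝ ∞ fun p : ℝ × (Fin r → V) => moments Z f p.1 (stageCurve X y₀ p.1 p.2) := by
  refine contDiff_pi.2 fun i => ?_
  exact contDiff_param_integral
    (F := fun q : (ℝ × (Fin r → V)) × ℝ =>
      Z i (q.1.1, q.2) • f (stageCurve X y₀ q.1.1 q.1.2 q.2))
    (((hZ i).comp (by fun_prop)).smul (hf.comp
      (contDiff_stageCurve hX (by fun_prop) (by fun_prop) (by fun_prop))))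

theorem stageCurve_moments (hZ : ∀ i, ContDiff ℝ ∞ (Z i)) (h τ : ℝ) {g : ℝ → V}
    (hg : ContinuousOn g (Icc 0 1)) :
    ∑ i, X i (h, τ) • ∫ σ in (0 : ℝ)..1, Z i (h, σ) • g σ =
      ∫ σ in (0 : ℝ)..1, (∑ i, X i (h, τ) * Z i (h, σ)) • g σ := by
  simp only [Finset.sum_smul, mul_smul]
  rw [intervalIntegral.integral_finsetSum]
  · simp only [intervalIntegral.integral_smul]
  · intro i _
    refine ContinuousOn.intervalIntegrable_of_Icc zero_le_one ?_
    have : Continuous fun σ => Z i (h, σ) := (hZ i).continuous.comp (by fun_prop)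
    exact (this.continuousOn.smul hg).const_smul _

theorem intervalIntegrable_kernel_smul (hZ : ∀ i, ContDiff ℝ ∞ (Z i)) (hf : ContDiff ℝ ∞ f)
    (h τ : ℝ) {u : ℝ → V} (hu : ContinuousOn u (Icc 0 1)) :
    IntervalIntegrable (fun σ => (∑ i, X i (h, τ) * Z i (h, σ)) • f (u σ)) volume 0 1 := by
  have h1 : ∀ i, Continuous fun σ => Z i (h, σ) := fun i => (hZ i).continuous.comp (by fun_prop)
  exact ContinuousOn.intervalIntegrable_of_Icc zero_le_one
    ((continuous_finsetSum _ fun i _ => (h1 i).const_mul _).continuousOn.smul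
      (hf.continuous.comp_continuousOn hu))

variable {M D₀ D₁ R ε : ℝ}

/-- The one estimate behind the self-map property, the contraction, uniqueness and the invertibility
of the linearization. -/
theorem norm_kernel_integral_le {h τ D : ℝ} (hM : ∀ h ∈ Icc (0 : ℝ) 1, ∀ τ ∈ Icc (0 : ℝ) 1,
      ∀ σ ∈ Icc (0 : ℝ) 1, |∑ i, X i (h, τ) * Z i (h, σ)| ≤ M)
    (hh : h ∈ Icc 0 ε) (hε : ε < 1) (hτ : τ ∈ Icc (0 : ℝ) 1) {g : ℝ → V}
    (hg : ∀ σ ∈ Icc (0 : ℝ) 1, ‖g σ‖ ≤ D) :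
    ‖h • ∫ σ in (0 : ℝ)..1, (∑ i, X i (h, τ) * Z i (h, σ)) • g σ‖ ≤ ε * (M * D) := by
  have hh1 : h ∈ Icc (0 : ℝ) 1 := ⟨hh.1, hh.2.trans hε.le⟩
  have hM0 : 0 ≤ M := (abs_nonneg _).trans (hM h hh1 τ hτ τ hτ)
  have hD0 : 0 ≤ D := (norm_nonneg _).trans (hg τ hτ)
  have h1 : ‖∫ σ in (0 : ℝ)..1, (∑ i, X i (h, τ) * Z i (h, σ)) • g σ‖ ≤ M * D * |1 - 0| := by
    refine intervalIntegral.norm_integral_le_of_norm_le_const fun σ hσ => ?_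
    rw [uIoc_of_le zero_le_one] at hσ
    have hσ' : σ ∈ Icc (0 : ℝ) 1 := ⟨hσ.1.le, hσ.2⟩
    rw [norm_smul]
    exact mul_le_mul (hM h hh1 τ hτ σ hσ') (hg σ hσ') (norm_nonneg _) hM0
  rw [sub_zero, abs_one, mul_one] at h1
  rw [norm_smul, Real.norm_of_nonneg hh.1]
  exact mul_le_mul hh.2 h1 (norm_nonneg _) (hh.1.trans hh.2)

/-- `u` solves the integral equation with the separable kernel `∑ i, X i (h, τ) Z i (h, σ)`. -/
def SolvesIntegralEq (X Z : Fin r → ℝ × ℝ → ℝ) (f : V → V) (y₀ : V) (h : ℝ) (u : ℝ → V) : Prop :=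
  ContinuousOn u (Icc 0 1) ∧ ∀ τ ∈ Icc (0 : ℝ) 1,
    u τ = y₀ + h • ∫ σ in (0 : ℝ)..1, (∑ i, X i (h, τ) * Z i (h, σ)) • f (u σ)

theorem moments_congr {h : ℝ} {u v : ℝ → V} (huv : EqOn u v (Icc 0 1)) :
    moments Z f h u = moments Z f h v := by
  ext i
  refine intervalIntegral.integral_congr fun σ hσ => ?_
  rw [uIcc_of_le zero_le_one] at hσ
  simp only [huv hσ]

theorem solvesIntegralEq_stageCurve (hX : ∀ i, ContDiff ℝ ∞ (X i))
    (hZ : ∀ i, ContDiff ℝ ∞ (Z i)) (hf : ContDiff ℝ ∞ f)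
    {h : ℝ} {a : Fin r → V} (ha : moments Z f h (stageCurve X y₀ h a) = a) :
    SolvesIntegralEq X Z f y₀ h (stageCurve X y₀ h a) := by
  have hc := continuous_stageCurve (y₀ := y₀) hX h a
  refine ⟨hc.continuousOn, fun τ hτ => ?_⟩
  rw [← stageCurve_moments (g := fun σ => f (stageCurve X y₀ h a σ)) hZ h τ
    (hf.continuous.comp hc).continuousOn]
  conv_lhs => rw [stageCurve, ← ha]
  simp only [moments]

theorem SolvesIntegralEq.unique (hf : ContDiff ℝ ∞ f)
    (hZ : ∀ i, ContDiff ℝ ∞ (Z i))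
    (hM : ∀ h ∈ Icc (0 : ℝ) 1, ∀ τ ∈ Icc (0 : ℝ) 1,
      ∀ σ ∈ Icc (0 : ℝ) 1, |∑ i, X i (h, τ) * Z i (h, σ)| ≤ M)
    (hD₁ : ∀ y ∈ Metric.closedBall y₀ R, ‖fderiv ℝ f y‖ ≤ D₁)
    (hε : ε < 1) (hε₁ : ε * (M * D₁) < 1) {h : ℝ} (hh : h ∈ Icc 0 ε) {u v : ℝ → V}
    (hu : SolvesIntegralEq X Z f y₀ h u) (hv : SolvesIntegralEq X Z f y₀ h v)
    (huR : MapsTo u (Icc 0 1) (Metric.closedBall y₀ R))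
    (hvR : MapsTo v (Icc 0 1) (Metric.closedBall y₀ R)) : EqOn u v (Icc 0 1) := by
  have key := eqOn_zero_of_contraction (hu.1.sub hv.1) hε₁ (fun δ hδ τ hτ => by
    have h1 : u τ - v τ = h • ∫ σ in (0 : ℝ)..1,
        (∑ i, X i (h, τ) * Z i (h, σ)) • (f (u σ) - f (v σ)) := by
      simp only [smul_sub]
      rw [hu.2 τ hτ, hv.2 τ hτ, intervalIntegral.integral_sub
          (intervalIntegrable_kernel_smul hZ hf h τ hu.1)
          (intervalIntegrable_kernel_smul hZ hf h τ hv.1), smul_sub,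
        add_sub_add_left_eq_sub]
    rw [Pi.sub_apply, h1, mul_assoc, mul_assoc]
    refine norm_kernel_integral_le hM hh hε hτ fun σ hσ => ?_
    have hL := (convex_closedBall y₀ R).norm_image_sub_le_of_norm_fderiv_le
      (fun y _ => hf.differentiable (by simp) y) hD₁ (hvR hσ) (huR hσ)
    refine hL.trans (mul_le_mul_of_nonneg_left (hδ σ hσ) ?_)
    exact (norm_nonneg _).trans (hD₁ _ (huR hσ)))
  exact fun τ hτ => sub_eq_zero.1 (key τ hτ)

theorem exists_fixedPoint_moments [CompleteSpace V] (hf : ContDiff ℝ ∞ f)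
    (hX : ∀ i, ContDiff ℝ ∞ (X i)) (hZ : ∀ i, ContDiff ℝ ∞ (Z i)) (hR : 0 < R)
    (hM : ∀ h ∈ Icc (0 : ℝ) 1, ∀ τ ∈ Icc (0 : ℝ) 1,
      ∀ σ ∈ Icc (0 : ℝ) 1, |∑ i, X i (h, τ) * Z i (h, σ)| ≤ M)
    (hD₀ : ∀ y ∈ Metric.closedBall y₀ R, ‖f y‖ ≤ D₀)
    (hD₁ : ∀ y ∈ Metric.closedBall y₀ R, ‖fderiv ℝ f y‖ ≤ D₁)
    (hε : ε < 1) (hε₀ : ε * (M * D₀) < R) (hε₁ : ε * (M * D₁) < 1)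
    {h : ℝ} (hh : h ∈ Icc 0 ε) :
    ∃ a : Fin r → V, moments Z f h (stageCurve X y₀ h a) = a ∧
      MapsTo (stageCurve X y₀ h a) (Icc 0 1) (Metric.ball y₀ R) := by
  set ext : C(Icc (0 : ℝ) 1, V) → ℝ → V := fun u => IccExtend zero_le_one u
  have hext : ∀ u, Continuous (ext u) := fun u => u.continuous.Icc_extend'
  have hexta : ∀ u (σ : ℝ) (hσ : σ ∈ Icc (0 : ℝ) 1), ext u σ = u ⟨σ, hσ⟩ :=
    fun u σ hσ => IccExtend_of_mem _ _ hσ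
  set S : Set C(Icc (0 : ℝ) 1, V) := {u | ∀ τ, u τ ∈ Metric.closedBall y₀ R}
  have hS : IsClosed S := by
    simp only [S, ofPred_forall]
    exact isClosed_iInter fun τ => Metric.isClosed_closedBall.preimage (by fun_prop)
  set T : C(Icc (0 : ℝ) 1, V) → C(Icc (0 : ℝ) 1, V) := fun u =>
    ⟨fun τ => stageCurve X y₀ h (moments Z f h (ext u)) τ,
      (continuous_stageCurve hX h _).comp continuous_subtype_val⟩
  have hT : ∀ u (τ : Icc (0 : ℝ) 1), T u τ = y₀ + h • ∫ σ in (0 : ℝ)..1,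
      (∑ i, X i (h, τ) * Z i (h, σ)) • f (ext u σ) := by
    intro u τ
    rw [← stageCurve_moments (g := fun σ => f (ext u σ)) hZ h τ
      (hf.continuous.comp (hext u)).continuousOn]
    rfl
  -- The strict bound `hε₀` gives the open ball, which leaves room to perturb `h` later.
  have hball : ∀ u ∈ S, ∀ τ, T u τ ∈ Metric.ball y₀ R := by
    intro u hu τ
    rw [hT, Metric.mem_ball, dist_eq_norm, add_sub_cancel_left]
    refine (norm_kernel_integral_le hM hh hε τ.2 fun σ hσ => hD₀ _ ?_).trans_lt hε₀
    rw [hexta u σ hσ]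
    exact hu _
  have hmaps : MapsTo T S S := fun u hu τ => Metric.ball_subset_closedBall (hball u hu τ)
  have hy : ContinuousMap.const (Icc (0 : ℝ) 1) y₀ ∈ S := fun τ => Metric.mem_closedBall_self hR.le
  have hD₁0 : 0 ≤ D₁ := (norm_nonneg _).trans (hD₁ y₀ (Metric.mem_closedBall_self hR.le))
  have hM0 : 0 ≤ M := (abs_nonneg _).trans (hM 0 (by simp) 0 (by simp) 0 (by simp))
  have hε0 : 0 ≤ ε := hh.1.trans hh.2
  have hκ0 : 0 ≤ ε * (M * D₁) := by positivity
  have hcon : ContractingWith ⟨ε * (M * D₁), hκ0⟩ (hmaps.restrict T S S) := by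
    refine ⟨by exact_mod_cast hε₁, LipschitzWith.of_dist_le_mul fun u v => ?_⟩
    rw [Subtype.dist_eq, Subtype.dist_eq, MapsTo.val_restrict_apply, MapsTo.val_restrict_apply]
    change dist (T u) (T v) ≤ ε * (M * D₁) * dist u.1 v.1
    refine (ContinuousMap.dist_le (by positivity)).2 fun τ => ?_
    have hint := fun u => intervalIntegrable_kernel_smul (X := X) hZ hf h τ (hext u).continuousOn
    rw [dist_eq_norm, hT, hT, add_sub_add_left_eq_sub, ← smul_sub,
      ← intervalIntegral.integral_sub (hint u) (hint v), mul_assoc, mul_assoc]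
    simp only [← smul_sub]
    refine norm_kernel_integral_le hM hh hε τ.2 fun σ hσ => ?_
    rw [hexta _ σ hσ, hexta _ σ hσ]
    have hL := (convex_closedBall y₀ R).norm_image_sub_le_of_norm_fderiv_le
      (fun y _ => hf.differentiable (by simp) y) hD₁ (v.2 ⟨σ, hσ⟩) (u.2 ⟨σ, hσ⟩)
    refine hL.trans (mul_le_mul_of_nonneg_left ?_ hD₁0)
    rw [← dist_eq_norm]
    exact ContinuousMap.dist_apply_le_dist _
  obtain ⟨u, huS, hu, -⟩ := hcon.exists_fixedPoint' hS.isComplete hmaps hy (edist_ne_top _ _)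
  have hEq : EqOn (ext u) (stageCurve X y₀ h (moments Z f h (ext u))) (Icc 0 1) := by
    intro τ hτ
    rw [hexta u τ hτ]
    conv_lhs => rw [← hu.eq]
    rfl
  refine ⟨moments Z f h (ext u), (moments_congr hEq).symm, fun τ hτ => ?_⟩
  exact hball u huS ⟨τ, hτ⟩

/-- The linearization of the fixed point equation for the moments is invertible. -/
theorem isInvertible_fderiv_moments [FiniteDimensional ℝ V] (hf : ContDiff ℝ ∞ f)
    (hX : ∀ i, ContDiff ℝ ∞ (X i)) (hZ : ∀ i, ContDiff ℝ ∞ (Z i))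
    (hM : ∀ h ∈ Icc (0 : ℝ) 1, ∀ τ ∈ Icc (0 : ℝ) 1,
      ∀ σ ∈ Icc (0 : ℝ) 1, |∑ i, X i (h, τ) * Z i (h, σ)| ≤ M)
    (hD₁ : ∀ y ∈ Metric.closedBall y₀ R, ‖fderiv ℝ f y‖ ≤ D₁)
    (hε : ε < 1) (hε₁ : ε * (M * D₁) < 1) {h : ℝ} (hh : h ∈ Icc 0 ε) {a : Fin r → V}
    (ha : MapsTo (stageCurve X y₀ h a) (Icc 0 1) (Metric.closedBall y₀ R)) :
    ((fderiv ℝ (fun p : ℝ × (Fin r → V) => p.2 - moments Z f p.1 (stageCurve X y₀ p.1 p.2))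
      (h, a)) ∘L .inr ℝ ℝ (Fin r → V)).IsInvertible := by
  refine isInvertible_of_injective _ fun v hv => ?_
  -- `w` is the derivative of the stage curve when the coefficients move in the direction `v`.
  set w : ℝ → V := fun τ => h • ∑ i, X i (h, τ) • v i
  have hXc : ∀ i, Continuous fun σ => X i (h, σ) := fun i => (hX i).continuous.comp (by fun_prop)
  have hw : Continuous w := by fun_prop
  have hUc := continuous_stageCurve (y₀ := y₀) hX h a
  have hg : Continuous fun σ => fderiv ℝ f (stageCurve X y₀ h a σ) (w σ) :=
    ((hf.continuous_fderiv (by simp)).comp hUc).clm_apply hw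
  have hline : ∀ i, HasDerivAt (fun s : ℝ => moments Z f h (stageCurve X y₀ h (a + s • v)) i)
      (∫ σ in (0 : ℝ)..1, Z i (h, σ) • fderiv ℝ f (stageCurve X y₀ h a σ) (w σ)) 0 := by
    intro i
    set F : ℝ × ℝ → V := fun q => Z i (h, q.2) • f (stageCurve X y₀ h (a + q.1 • v) q.2)
    have hF : ContDiff ℝ ∞ F := ((hZ i).comp (by fun_prop)).smul (hf.comp
      (contDiff_stageCurve hX contDiff_const (by fun_prop) (by fun_prop)))
    have h1 := (hasFDerivAt_param_integral (F := F) (hF.of_le (by simp)) 0).hasDerivAt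
    have hFc : Continuous fun θ => (fderiv ℝ F (0, θ)).comp (ContinuousLinearMap.inl ℝ ℝ ℝ) := by
      have := (hF.continuous_fderiv (by simp)).comp
        (by fun_prop : Continuous fun θ : ℝ => ((0 : ℝ), θ))
      exact this.clm_comp continuous_const
    rw [ContinuousLinearMap.intervalIntegral_apply (hFc.intervalIntegrable _ _)] at h1
    refine h1.congr_deriv (Eq.symm ?_)
    refine intervalIntegral.integral_congr fun σ _ => ?_
    have h2 : HasFDerivAt (fun s => F (s, σ))
        ((fderiv ℝ F (0, σ)).comp (ContinuousLinearMap.inl ℝ ℝ ℝ)) 0 :=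
      (hF.differentiable (by simp) (0, σ)).hasFDerivAt.comp (g := F) (f := fun s : ℝ => (s, σ)) 0
        (hasFDerivAt_prodMk_left 0 σ)
    have h3 : HasDerivAt (fun s : ℝ => stageCurve X y₀ h (a + s • v) σ) (w σ) 0 := by
      have h4 : (fun s : ℝ => stageCurve X y₀ h (a + s • v) σ) =
          fun s => stageCurve X y₀ h a σ + s • w σ := by
        ext s
        simp only [stageCurve, w, Pi.add_apply, Pi.smul_apply, smul_add, Finset.sum_add_distrib,
          add_assoc, smul_comm _ s, ← Finset.smul_sum]
      rw [h4]
      simpa using ((hasDerivAt_id (0 : ℝ)).smul_const (w σ)).const_add (stageCurve X y₀ h a σ)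
    have h5 : stageCurve X y₀ h (a + (0 : ℝ) • v) σ = stageCurve X y₀ h a σ := by simp
    have h6 := ((hf.differentiable (by simp) _).hasFDerivAt.comp_hasDerivAt 0 h3).const_smul
      (Z i (h, σ))
    rw [h5] at h6
    exact h6.unique h2.hasDerivAt
  have hv' : v = fun i => ∫ σ in (0 : ℝ)..1,
      Z i (h, σ) • fderiv ℝ f (stageCurve X y₀ h a σ) (w σ) := by
    have hG : ContDiff ℝ ∞ fun p : ℝ × (Fin r → V) =>
        p.2 - moments Z f p.1 (stageCurve X y₀ p.1 p.2) :=
      contDiff_snd.sub (contDiff_moments hX hZ hf)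
    have h1 : HasDerivAt (fun s : ℝ => ((h, a + s • v) : ℝ × (Fin r → V))) (0, v) 0 := by
      have := ((hasDerivAt_id (0 : ℝ)).smul_const v).const_add a
      simpa using (hasDerivAt_const (0 : ℝ) h).prodMk this
    have h0 : ((h, a) : ℝ × (Fin r → V)) = (h, a + (0 : ℝ) • v) := by simp
    rw [h0] at hv
    have h2 := (hG.differentiable (by simp) _).hasFDerivAt.comp_hasDerivAt 0 h1
    have h3 : HasDerivAt (fun s : ℝ => (a + s • v) -
        moments Z f h (stageCurve X y₀ h (a + s • v)))
        (v - fun i => ∫ σ in (0 : ℝ)..1,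
          Z i (h, σ) • fderiv ℝ f (stageCurve X y₀ h a σ) (w σ)) 0 := by
      refine HasDerivAt.sub ?_ (hasDerivAt_pi.2 hline)
      simpa using ((hasDerivAt_id (0 : ℝ)).smul_const v).const_add a
    exact sub_eq_zero.1 ((h3.unique h2).trans hv)
  -- By `hv'`, `w` solves the linearized homogeneous integral equation, again a contraction. Then `v
  -- = 0` follows from `hv'`, not from the definition of `w`, which loses `v` at `h = 0`.
  have hw0 : ∀ τ ∈ Icc (0 : ℝ) 1, w τ = 0 := by
    refine eqOn_zero_of_contraction hw.continuousOn hε₁ fun δ hδ τ hτ => ?_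
    have h1 : w τ = h • ∫ σ in (0 : ℝ)..1, (∑ i, X i (h, τ) * Z i (h, σ)) •
        fderiv ℝ f (stageCurve X y₀ h a σ) (w σ) := by
      rw [← stageCurve_moments hZ h τ hg.continuousOn]
      simp only [w]
      conv_lhs => rw [hv']
    rw [h1, mul_assoc, mul_assoc]
    refine norm_kernel_integral_le hM hh hε hτ fun σ hσ => ?_
    exact (ContinuousLinearMap.le_opNorm _ _).trans (mul_le_mul (hD₁ _ (ha hσ)) (hδ σ hσ)
      (norm_nonneg _) ((norm_nonneg _).trans (hD₁ _ (ha hσ))))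
  rw [hv']
  ext i
  refine (intervalIntegral.integral_congr (g := fun _ => (0 : V)) fun σ hσ => ?_).trans (by simp)
  rw [uIcc_of_le zero_le_one] at hσ
  simp only [hw0 σ hσ, map_zero, smul_zero]

/-- The integral equation with a smooth separable kernel has a solution that is smooth in the
parameter `h` as well. -/
theorem exists_contDiffOn_solvesIntegralEq [FiniteDimensional ℝ V] (hf : ContDiff ℝ ∞ f)
    (hX : ∀ i, ContDiff ℝ ∞ (X i)) (hZ : ∀ i, ContDiff ℝ ∞ (Z i)) (hR : 0 < R)
    (hM : ∀ h ∈ Icc (0 : ℝ) 1, ∀ τ ∈ Icc (0 : ℝ) 1,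
      ∀ σ ∈ Icc (0 : ℝ) 1, |∑ i, X i (h, τ) * Z i (h, σ)| ≤ M)
    (hD₀ : ∀ y ∈ Metric.closedBall y₀ R, ‖f y‖ ≤ D₀)
    (hD₁ : ∀ y ∈ Metric.closedBall y₀ R, ‖fderiv ℝ f y‖ ≤ D₁)
    (hε : ε < 1) (hε₀ : ε * (M * D₀) < R) (hε₁ : ε * (M * D₁) < 1) :
    ∃ u : ℝ → ℝ → V, (∀ h ∈ Icc 0 ε, SolvesIntegralEq X Z f y₀ h (u h) ∧
      MapsTo (u h) (Icc 0 1) (Metric.closedBall y₀ R)) ∧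
      ContDiffOn ℝ ∞ (fun p : ℝ × ℝ => u p.1 p.2) (Icc 0 ε ×ˢ Icc 0 1) := by
  have := FiniteDimensional.complete ℝ V
  have hex : ∀ h, ∃ a : Fin r → V, h ∈ Icc 0 ε → moments Z f h (stageCurve X y₀ h a) = a ∧
      MapsTo (stageCurve X y₀ h a) (Icc 0 1) (Metric.ball y₀ R) := by
    intro h
    by_cases hh : h ∈ Icc 0 ε
    · obtain ⟨a, ha⟩ := exists_fixedPoint_moments hf hX hZ hR hM hD₀ hD₁ hε hε₀ hε₁ hh
      exact ⟨a, fun _ => ha⟩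
    · exact ⟨0, fun h' => absurd h' hh⟩
  choose a ha using hex
  have hsol : ∀ h ∈ Icc 0 ε, SolvesIntegralEq X Z f y₀ h (stageCurve X y₀ h (a h)) ∧
      MapsTo (stageCurve X y₀ h (a h)) (Icc 0 1) (Metric.closedBall y₀ R) := fun h hh =>
    ⟨solvesIntegralEq_stageCurve hX hZ hf (ha h hh).1,
      (ha h hh).2.mono_right Metric.ball_subset_closedBall⟩
  refine ⟨fun h => stageCurve X y₀ h (a h), hsol, ?_⟩
  rintro ⟨h₀, τ₀⟩ ⟨hh₀, hτ₀⟩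
  have hG : ContDiffAt ℝ ∞ (fun p : ℝ × (Fin r → V) =>
      p.2 - moments Z f p.1 (stageCurve X y₀ p.1 p.2)) (h₀, a h₀) :=
    (contDiff_snd.sub (contDiff_moments hX hZ hf)).contDiffAt
  have hinv := isInvertible_fderiv_moments hf hX hZ hM hD₁ hε hε₁ hh₀ (hsol h₀ hh₀).2
  set b := hG.implicitFunction (by simp) hinv
  have hb : ContDiffAt ℝ ∞ b h₀ := hG.contDiffAt_implicitFunction (by simp) hinv
  have hb0 : b h₀ = a h₀ := hG.implicitFunction_apply_self (by simp) hinv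
  have hbG : ∀ᶠ h in 𝓝 h₀, moments Z f h (stageCurve X y₀ h (b h)) = b h := by
    filter_upwards [hG.eventually_apply_implicitFunction (by simp) hinv] with h hh
    simp only [(ha h₀ hh₀).1, sub_self] at hh
    exact (sub_eq_zero.1 hh).symm
  have hcont : ∀ τ, ContDiffAt ℝ ∞ (fun p : ℝ × ℝ => stageCurve X y₀ p.1 (b p.1) p.2) (h₀, τ) := by
    intro τ
    have h1 : ContDiff ℝ ∞ fun q : ℝ × (Fin r → V) × ℝ => stageCurve X y₀ q.1 q.2.1 q.2.2 :=
      contDiff_stageCurve hX (by fun_prop) (by fun_prop) (by fun_prop)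
    have h2 : ContDiffAt ℝ ∞ (fun p : ℝ × ℝ => b p.1) (h₀, τ) :=
      ContDiffAt.comp (h₀, τ) hb contDiffAt_fst
    exact h1.contDiffAt.comp (h₀, τ) (contDiffAt_fst.prodMk (h2.prodMk contDiffAt_snd))
  -- Uniqueness holds only inside the ball, so the implicit branch must stay there for all `τ` at
  -- once.
  have hbR : ∀ᶠ h in 𝓝 h₀, ∀ τ ∈ Icc (0 : ℝ) 1,
      stageCurve X y₀ h (b h) τ ∈ Metric.ball y₀ R := by
    apply isCompact_Icc.eventually_forall_of_forall_eventually
    intro τ hτ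
    have h1 := (hcont τ).continuousAt
    refine h1.eventually (Metric.isOpen_ball.mem_nhds ?_)
    simp only [hb0]
    exact (ha h₀ hh₀).2 hτ
  refine ((hcont τ₀).contDiffWithinAt).congr_of_eventuallyEq ?_ ?_
  · have h1 : ∀ᶠ p : ℝ × ℝ in 𝓝[Icc 0 ε ×ˢ Icc 0 1] (h₀, τ₀),
        moments Z f p.1 (stageCurve X y₀ p.1 (b p.1)) = b p.1 ∧
        ∀ τ ∈ Icc (0 : ℝ) 1, stageCurve X y₀ p.1 (b p.1) τ ∈ Metric.ball y₀ R :=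
      ((continuous_fst.tendsto (h₀, τ₀)).eventually (hbG.and hbR)).filter_mono
        nhdsWithin_le_nhds
    filter_upwards [h1, self_mem_nhdsWithin] with p hp hmem
    exact SolvesIntegralEq.unique hf hZ hM hD₁ hε hε₁ hmem.1 (hsol _ hmem.1).1
      (solvesIntegralEq_stageCurve hX hZ hf hp.1) (hsol _ hmem.1).2
      (fun τ hτ => Metric.ball_subset_closedBall (hp.2 τ hτ)) hmem.2
  · simp only [hb0]

end

/-! ### Equivalence of the variational and the Runge–Kutta form -/

namespace FFCFE

variable {d r : ℕ} {φ : Fin r → ℝ → ℝ} {t₀ h : ℝ}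

theorem mem_rescaled_ySpace_iff {v : ℝ → Fin d → ℝ} :
    v ∈ rescaled (ySpace d φ) t₀ h ↔
      ∃ W : Fin r → Fin d → ℝ, ∀ τ ∈ Icc (0 : ℝ) 1, v τ = ∑ i, φ i (t₀ + τ * h) • W i := by
  constructor
  · rintro ⟨w, ⟨W, hW⟩, hv⟩
    exact ⟨W, fun τ hτ => by rw [hv τ hτ, hW]⟩
  · rintro ⟨W, hW⟩
    exact ⟨_, ⟨W, fun _ => rfl⟩, hW⟩

theorem mem_rescaled_xSpace_iff {u : ℝ → Fin d → ℝ} :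
    u ∈ rescaled (xSpace d φ t₀) t₀ h ↔
      ∃ (c : Fin d → ℝ) (W : Fin r → Fin d → ℝ), ∀ τ ∈ Icc (0 : ℝ) 1,
        u τ = c + h • ∑ i, (∫ α in (0 : ℝ)..τ, φ i (t₀ + α * h)) • W i := by
  have hint : ∀ i τ, ∫ s in t₀..(t₀ + τ * h), φ i s =
      h * ∫ α in (0 : ℝ)..τ, φ i (t₀ + α * h) := by
    intro i τ
    have := intervalIntegral.mul_integral_comp_add_mul (f := φ i) (a := 0) (b := τ) h t₀
    simp only [mul_comm h, zero_mul, add_zero] at this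
    rw [mul_comm h, this]
  have hsum : ∀ (W : Fin (r + 1) → Fin d → ℝ) τ,
      ∑ i, (Fin.cons (fun _ => 1) (fun i t => ∫ s in t₀..t, φ i s) : Fin (r + 1) → ℝ → ℝ) i
        (t₀ + τ * h) • W i =
      W 0 + h • ∑ i, (∫ α in (0 : ℝ)..τ, φ i (t₀ + α * h)) • W i.succ := by
    intro W τ
    rw [Fin.sum_univ_succ]
    simp only [Fin.cons_zero, Fin.cons_succ, one_smul, hint, mul_smul, Finset.smul_sum]
  constructor
  · rintro ⟨w, ⟨W, hW⟩, hu⟩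
    exact ⟨W 0, fun i => W i.succ, fun τ hτ => by rw [hu τ hτ, hW, hsum]⟩
  · rintro ⟨c, W, hu⟩
    refine ⟨_, ⟨Fin.cons c W, fun _ => rfl⟩, fun τ hτ => ?_⟩
    rw [hu τ hτ, hsum]
    simp only [Fin.cons_zero, Fin.cons_succ]

theorem derivWithin_trial (hφ : ∀ i, Continuous (φ i)) {u : ℝ → Fin d → ℝ} {c : Fin d → ℝ}
    {W : Fin r → Fin d → ℝ} (hu : ∀ τ ∈ Icc (0 : ℝ) 1,
      u τ = c + h • ∑ i, (∫ α in (0 : ℝ)..τ, φ i (t₀ + α * h)) • W i)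
    {τ : ℝ} (hτ : τ ∈ Icc (0 : ℝ) 1) :
    derivWithin u (Icc 0 1) τ = h • ∑ i, φ i (t₀ + τ * h) • W i := by
  have h1 : HasDerivAt (fun τ => c + h • ∑ i, (∫ α in (0 : ℝ)..τ, φ i (t₀ + α * h)) • W i)
      (h • ∑ i, φ i (t₀ + τ * h) • W i) τ := by
    refine ((HasDerivAt.fun_sum fun i _ => HasDerivAt.smul_const ?_ (W i)).const_smul h).const_add c
    have hc : Continuous fun α => φ i (t₀ + α * h) := (hφ i).comp (by fun_prop)
    exact hc.integral_hasStrictDerivAt 0 τ |>.hasDerivAt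
  exact (h1.hasDerivWithinAt.congr hu (hu τ hτ)).derivWithin (uniqueDiffOn_Icc zero_lt_one τ hτ)

theorem integral_test_mul {p : Fin r → ℝ → ℝ} (hp : ∀ i, Continuous (p i))
    {g : ℝ → Fin d → ℝ} (hg : ContinuousOn g (Icc 0 1)) (V : Fin r → Fin d → ℝ) :
    ∫ τ in (0 : ℝ)..1, (∑ k, p k τ • V k) * g τ = ∑ k, V k * ∫ τ in (0 : ℝ)..1, p k τ • g τ := by
  have hint : ∀ k, IntervalIntegrable (fun τ => p k τ • g τ) volume 0 1 := fun k =>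
    ContinuousOn.intervalIntegrable_of_Icc zero_le_one ((hp k).continuousOn.smul hg)
  have h1 : ∀ τ, (∑ k, p k τ • V k) * g τ = ∑ k, V k * (p k τ • g τ) := by
    intro τ
    rw [Finset.sum_mul]
    exact Finset.sum_congr rfl fun k _ => by rw [smul_mul_assoc, mul_smul_comm]
  simp only [h1]
  rw [intervalIntegral.integral_finsetSum]
  · refine Finset.sum_congr rfl fun k _ => ?_
    exact (ContinuousLinearMap.mul ℝ (Fin d → ℝ) (V k)).intervalIntegral_comp_comm (hint k)
  · exact fun k _ => (hint k).continuousOn_mul continuousOn_const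

theorem gram_smul_eq (hφ : ∀ i, Continuous (φ i)) (W : Fin r → Fin d → ℝ) (k : Fin r) :
    ∫ τ in (0 : ℝ)..1, φ k (t₀ + τ * h) • (h • ∑ i, φ i (t₀ + τ * h) • W i) =
      h • ∑ i, gram φ t₀ h k i • W i := by
  have hp : ∀ i, Continuous fun τ => φ i (t₀ + τ * h) := fun i => (hφ i).comp (by fun_prop)
  simp only [Finset.smul_sum, smul_smul]
  rw [intervalIntegral.integral_finsetSum]
  · simp only [intervalIntegral.integral_smul_const, mul_left_comm _ h,
      intervalIntegral.integral_const_mul, gram, Matrix.of_apply]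
  · exact fun i _ => Continuous.intervalIntegrable (by fun_prop) _ _

/-- Testing with `φ k` times the all-ones vector gives one equation per `k`; a general test function
is an entrywise combination of these. The factor `h` stays on both sides so that `h = 0` is covered.
-/
theorem isVariationalSolution_iff (hφ : ∀ i, Continuous (φ i)) {f : (Fin d → ℝ) → Fin d → ℝ}
    (hf : Continuous f) {y₀ : Fin d → ℝ} {u : ℝ → Fin d → ℝ} :
    IsVariationalSolution φ t₀ f y₀ h u ↔ ∃ W : Fin r → Fin d → ℝ,
      (∀ τ ∈ Icc (0 : ℝ) 1,
        u τ = y₀ + h • ∑ i, (∫ α in (0 : ℝ)..τ, φ i (t₀ + α * h)) • W i) ∧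
      ∀ k, h • ∑ i, gram φ t₀ h k i • W i =
        h • ∫ τ in (0 : ℝ)..1, φ k (t₀ + τ * h) • f (u τ) := by
  have hp : ∀ i, Continuous fun τ => φ i (t₀ + τ * h) := fun i => (hφ i).comp (by fun_prop)
  have hcont : ∀ {c : Fin d → ℝ} {W : Fin r → Fin d → ℝ}, (∀ τ ∈ Icc (0 : ℝ) 1,
      u τ = c + h • ∑ i, (∫ α in (0 : ℝ)..τ, φ i (t₀ + α * h)) • W i) →
      ContinuousOn (fun τ => f (u τ)) (Icc 0 1) := by
    intro c W hu
    refine hf.comp_continuousOn (ContinuousOn.congr (Continuous.continuousOn ?_) hu)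
    have : ∀ i, Continuous fun τ => ∫ α in (0 : ℝ)..τ, φ i (t₀ + α * h) :=
      fun i => intervalIntegral.continuous_primitive
        (fun a b => (hp i).intervalIntegrable a b) 0
    fun_prop
  have htest : ∀ {c : Fin d → ℝ} {W : Fin r → Fin d → ℝ}, (∀ τ ∈ Icc (0 : ℝ) 1,
      u τ = c + h • ∑ i, (∫ α in (0 : ℝ)..τ, φ i (t₀ + α * h)) • W i) →
      ∀ (V : Fin r → Fin d → ℝ) (v : ℝ → Fin d → ℝ),
      (∀ τ ∈ Icc (0 : ℝ) 1, v τ = ∑ i, φ i (t₀ + τ * h) • V i) →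
      ∫ τ in (0 : ℝ)..1, v τ * derivWithin u (Icc 0 1) τ =
        ∑ k, V k * (h • ∑ i, gram φ t₀ h k i • W i) ∧
      h • ∫ τ in (0 : ℝ)..1, v τ * f (u τ) =
        ∑ k, V k * (h • ∫ τ in (0 : ℝ)..1, φ k (t₀ + τ * h) • f (u τ)) := by
    intro c W hu V v hv
    constructor
    · have h1 : ∫ τ in (0 : ℝ)..1, v τ * derivWithin u (Icc 0 1) τ =
          ∫ τ in (0 : ℝ)..1, (∑ i, φ i (t₀ + τ * h) • V i) *
            (h • ∑ i, φ i (t₀ + τ * h) • W i) := by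
        refine intervalIntegral.integral_congr fun τ hτ => ?_
        rw [uIcc_of_le zero_le_one] at hτ
        simp only [hv τ hτ, derivWithin_trial hφ hu hτ]
      rw [h1, integral_test_mul hp (Continuous.continuousOn (by fun_prop))]
      simp only [gram_smul_eq hφ]
    · have h1 : ∫ τ in (0 : ℝ)..1, v τ * f (u τ) =
          ∫ τ in (0 : ℝ)..1, (∑ i, φ i (t₀ + τ * h) • V i) * f (u τ) := by
        refine intervalIntegral.integral_congr fun τ hτ => ?_
        rw [uIcc_of_le zero_le_one] at hτ
        simp only [hv τ hτ]
      rw [h1, integral_test_mul hp (hcont hu), Finset.smul_sum]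
      simp only [mul_smul_comm]
  constructor
  · rintro ⟨hX, h0, hvar⟩
    obtain ⟨c, W, hu⟩ := mem_rescaled_xSpace_iff.1 hX
    have hc : c = y₀ := by
      rw [← h0, hu 0 (by simp)]
      simp
    subst hc
    refine ⟨W, hu, fun k => ?_⟩
    have h1 := hvar _ (mem_rescaled_ySpace_iff.2 ⟨Pi.single k 1, fun _ _ => rfl⟩)
    obtain ⟨h2, h3⟩ := htest hu (Pi.single k 1) _ fun _ _ => rfl
    rw [h2, h3] at h1
    simpa [Pi.single_apply, ite_mul] using h1
  · rintro ⟨W, hu, hW⟩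
    refine ⟨mem_rescaled_xSpace_iff.2 ⟨y₀, W, hu⟩, by rw [hu 0 (by simp)]; simp, fun v hv => ?_⟩
    obtain ⟨V, hV⟩ := mem_rescaled_ySpace_iff.1 hv
    obtain ⟨h2, h3⟩ := htest hu V v hV
    rw [h2, h3]
    exact Finset.sum_congr rfl fun k _ => by rw [hW]

theorem sum_smul_sum_of_mul_eq_one {G : Type} [AddCommGroup G] [Module ℝ G]
    {A B : Matrix (Fin r) (Fin r) ℝ} (hAB : A * B = 1) (m : Fin r → G) (k : Fin r) :
    ∑ i, A k i • ∑ j, B i j • m j = m k := by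
  simp only [Finset.smul_sum, smul_smul]
  rw [Finset.sum_comm]
  simp only [← Finset.sum_smul, ← Matrix.mul_apply, hAB, Matrix.one_apply, ite_smul, one_smul,
    zero_smul, Finset.sum_ite_eq, Finset.mem_univ, if_true]

/-- The integral form is the Gram system solved for `W`: the kernel contains the inverse Gram matrix
applied to the moments of `f ∘ u`. -/
theorem isRKSolution_iff_of_ne_zero (hφ : ∀ i, ContDiff ℝ ∞ (φ i)) (hh : h ≠ 0)
    (hdet : (gram φ t₀ h).det ≠ 0) {f : (Fin d → ℝ) → Fin d → ℝ}
    (hf : Continuous f) {y₀ : Fin d → ℝ} {u : ℝ → Fin d → ℝ} :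
    IsRKSolution φ t₀ f y₀ h u ↔ ∃ W : Fin r → Fin d → ℝ,
      (∀ τ ∈ Icc (0 : ℝ) 1,
        u τ = y₀ + h • ∑ i, (∫ α in (0 : ℝ)..τ, φ i (t₀ + α * h)) • W i) ∧
      ∀ k, ∑ i, gram φ t₀ h k i • W i = ∫ τ in (0 : ℝ)..1, φ k (t₀ + τ * h) • f (u τ) := by
  have hp : ∀ i, Continuous fun τ => φ i (t₀ + τ * h) :=
    fun i => (hφ i).continuous.comp (by fun_prop)
  set m : Fin r → Fin d → ℝ := fun k => ∫ τ in (0 : ℝ)..1, φ k (t₀ + τ * h) • f (u τ)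
  have hker : ∀ (τ : ℝ), ContinuousOn u (Icc 0 1) →
      ∫ σ in (0 : ℝ)..1, rkKernel φ t₀ h τ σ • f (u σ) =
      ∑ i, (∫ α in (0 : ℝ)..τ, φ i (t₀ + α * h)) • ∑ j, (gram φ t₀ h)⁻¹ i j • m j := by
    intro τ hu
    have hc : ∀ (b c : ℝ) j,
        ContinuousOn (fun σ => b • c • φ j (t₀ + σ * h) • f (u σ)) (Icc 0 1) := fun b c j =>
      (((hp j).continuousOn.smul (hf.comp_continuousOn hu)).const_smul c).const_smul b
    simp only [rkKernel_eq_of_ne_zero hφ hh, Finset.sum_smul, mul_smul, Finset.smul_sum]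
    rw [intervalIntegral.integral_finsetSum]
    · refine Finset.sum_congr rfl fun i _ => ?_
      rw [intervalIntegral.integral_finsetSum]
      · simp only [intervalIntegral.integral_smul, m]
      · exact fun j _ => (hc _ _ j).intervalIntegrable_of_Icc zero_le_one
    · exact fun i _ => (continuousOn_finsetSum _ fun j _ =>
        hc _ _ j).intervalIntegrable_of_Icc zero_le_one
  have hunit := isUnit_iff_ne_zero.2 hdet
  constructor
  · rintro ⟨hc, hu⟩
    refine ⟨fun i => ∑ j, (gram φ t₀ h)⁻¹ i j • m j, fun τ hτ => ?_, fun k => ?_⟩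
    · rw [hu τ hτ, hker τ hc]
    · exact sum_smul_sum_of_mul_eq_one (Matrix.mul_nonsing_inv _ hunit) m k
  · rintro ⟨W, hu, hW⟩
    have hc : ContinuousOn u (Icc 0 1) := by
      refine ContinuousOn.congr (Continuous.continuousOn ?_) hu
      have : ∀ i, Continuous fun τ => ∫ α in (0 : ℝ)..τ, φ i (t₀ + α * h) :=
        fun i => intervalIntegral.continuous_primitive
          (fun a b => (hp i).intervalIntegrable a b) 0
      fun_prop
    refine ⟨hc, fun τ hτ => ?_⟩
    have hW' : ∀ k, ∑ i, gram φ t₀ h k i • W i = m k := hW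
    have : ∀ i, ∑ j, (gram φ t₀ h)⁻¹ i j • m j = W i := fun i => by
      simp only [← hW']
      exact sum_smul_sum_of_mul_eq_one (Matrix.nonsing_inv_mul _ hunit) W i
    rw [hu τ hτ, hker τ hc]
    simp only [this]

theorem isVariationalSolution_iff_isRKSolution (hφ : ∀ i, ContDiff ℝ ∞ (φ i))
    (hdet : h ≠ 0 → (gram φ t₀ h).det ≠ 0) {f : (Fin d → ℝ) → Fin d → ℝ}
    (hf : Continuous f) {y₀ : Fin d → ℝ} {u : ℝ → Fin d → ℝ} :
    IsVariationalSolution φ t₀ f y₀ h u ↔ IsRKSolution φ t₀ f y₀ h u := by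
  rw [isVariationalSolution_iff (fun i => (hφ i).continuous) hf]
  rcases eq_or_ne h 0 with rfl | hh
  · simp only [zero_smul, add_zero, implies_true, and_true, exists_const, IsRKSolution]
    exact ⟨fun hu => ⟨continuousOn_const.congr hu, hu⟩, fun hu => hu.2⟩
  · rw [isRKSolution_iff_of_ne_zero hφ hh (hdet hh) hf]
    simp only [smul_right_inj hh]

theorem norm_iteratedFDeriv_le_derivMax {f : (Fin d → ℝ) → Fin d → ℝ} (hf : ContDiff ℝ ∞ f)
    (y₀ : Fin d → ℝ) (R : ℝ) (n : ℕ) {y : Fin d → ℝ} (hy : y ∈ Metric.closedBall y₀ R) :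
    ‖iteratedFDeriv ℝ n f y‖ ≤ derivMax f y₀ R n := by
  refine le_csSup ?_ (mem_image_of_mem _ hy)
  exact ((isCompact_closedBall y₀ R).image
    (hf.continuous_iteratedFDeriv (by exact_mod_cast le_top)).norm).bddAbove

end FFCFE

/-! ### The existence, uniqueness and smoothness theorem -/

/-- The bounds on `ε` are written as products, which agrees with reading a quotient with denominator
`0` as `+∞`. -/
theorem mainTheorem2 {d r : ℕ} (t₀ T : ℝ) (hT : t₀ < T)
    (φ : Fin r → ℝ → ℝ)
    (hφ_smooth : ∀ i, ContDiffOn ℝ ∞ (φ i) (Icc t₀ T))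
    (hφ_indep : LinearIndependent ℝ (fun (i : Fin r) (t : Icc t₀ T) => φ i t))
    (hφ_inv : FFCFE.Invariant (FFCFE.ySpace d φ))
    (f : (Fin d → ℝ) → Fin d → ℝ) (hf : ContDiff ℝ ∞ f)
    (y₀ : Fin d → ℝ) (R : ℝ) (hR : 0 < R) (ε : ℝ)
    (hε₁ : ε * (FFCFE.kernelMax φ t₀ * FFCFE.derivMax f y₀ R 1) < 1)
    (hε₂ : ε * (FFCFE.kernelMax φ t₀ * FFCFE.derivMax f y₀ R 0) < R)
    (hε₃ : ε < 1) :
    ∃ u : ℝ → ℝ → Fin d → ℝ,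
      (∀ h ∈ Icc (0 : ℝ) ε,
        MapsTo (u h) (Icc 0 1) (Metric.closedBall y₀ R) ∧
        FFCFE.IsVariationalSolution φ t₀ f y₀ h (u h) ∧
        FFCFE.IsRKSolution φ t₀ f y₀ h (u h) ∧
        (∀ v : ℝ → Fin d → ℝ, MapsTo v (Icc 0 1) (Metric.closedBall y₀ R) →
          FFCFE.IsVariationalSolution φ t₀ f y₀ h v → EqOn v (u h) (Icc 0 1)) ∧
        (∀ v : ℝ → Fin d → ℝ, MapsTo v (Icc 0 1) (Metric.closedBall y₀ R) →
          FFCFE.IsRKSolution φ t₀ f y₀ h v → EqOn v (u h) (Icc 0 1))) ∧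
      ContDiffOn ℝ ∞ (fun p : ℝ × ℝ => u p.1 p.2) (Icc 0 ε ×ˢ Icc 0 1) := by
  -- For `d = 0` invariance says nothing about `φ`, but all values lie in a one-point space.
  rcases Nat.eq_zero_or_pos d with rfl | hd
  · refine ⟨fun _ _ => y₀, fun h _ => ⟨fun _ _ => Metric.mem_closedBall_self hR.le, ?_, ?_, ?_, ?_⟩,
      contDiffOn_const⟩
    · exact ⟨⟨_, ⟨0, fun _ => rfl⟩, fun _ _ => Subsingleton.elim _ _⟩, rfl,
        fun _ _ => Subsingleton.elim _ _⟩
    · exact ⟨continuousOn_const, fun _ _ => Subsingleton.elim _ _⟩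
    · exact fun _ _ _ _ _ => Subsingleton.elim _ _
    · exact fun _ _ _ _ _ => Subsingleton.elim _ _
  have htr := fun i c => hφ_inv.exists_translate hd i c
  have hφ := contDiff_of_translate hT hφ_smooth htr
  obtain ⟨hne, χ, hχ, hind, hC⟩ := exists_regular_basis hφ htr hφ_indep
  have hdet : ∀ h ≠ 0, (FFCFE.gram φ t₀ h).det ≠ 0 := fun h hh =>
    det_gram_ne_zero (v := fun i τ => φ i (t₀ + τ * h))
      (fun i => (hφ i).continuous.comp (by fun_prop)) (hne h hh)
  have hker := rkKernel_eq_of_basis hχ hind hdet hC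
  have hX := contDiff_basisPrimitive hχ
  have hZ := contDiff_dualBasis hχ hind
  have hiff : ∀ h u, FFCFE.IsVariationalSolution φ t₀ f y₀ h u ↔
      FFCFE.IsRKSolution φ t₀ f y₀ h u := fun h u =>
    FFCFE.isVariationalSolution_iff_isRKSolution hφ (hdet h) hf.continuous
  have hRK : ∀ h u, FFCFE.IsRKSolution φ t₀ f y₀ h u ↔
      SolvesIntegralEq (basisPrimitive χ) (dualBasis χ) f y₀ h u := by
    intro h u
    simp only [FFCFE.IsRKSolution, SolvesIntegralEq, hker]
  have hM : ∀ h ∈ Icc (0 : ℝ) 1, ∀ τ ∈ Icc (0 : ℝ) 1, ∀ σ ∈ Icc (0 : ℝ) 1,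
      |∑ i, basisPrimitive χ i (h, τ) * dualBasis χ i (h, σ)| ≤ FFCFE.kernelMax φ t₀ := by
    intro h hh τ hτ σ hσ
    -- The supremum bounds the kernel only once the set is known to be bounded; this uses continuity
    -- up to `h = 0` on a compact cube.
    refine le_csSup ?_ ⟨h, hh, τ, hτ, σ, hσ, by rw [hker]⟩
    have hcont : Continuous fun p : ℝ × ℝ × ℝ =>
        |∑ i, basisPrimitive χ i (p.1, p.2.1) * dualBasis χ i (p.1, p.2.2)| :=
      (continuous_finsetSum _ fun i _ => ((hX i).continuous.comp (by fun_prop)).mul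
        ((hZ i).continuous.comp (by fun_prop))).abs
    refine (((isCompact_Icc (a := (0 : ℝ)) (b := 1)).prod ((isCompact_Icc (a := (0 : ℝ))
      (b := 1)).prod (isCompact_Icc (a := (0 : ℝ)) (b := 1)))).image hcont).bddAbove.mono ?_
    rintro x ⟨h, hh, τ, hτ, σ, hσ, rfl⟩
    exact ⟨(h, τ, σ), ⟨hh, hτ, hσ⟩, by simp only [hker]⟩
  have hD₀ : ∀ y ∈ Metric.closedBall y₀ R, ‖f y‖ ≤ FFCFE.derivMax f y₀ R 0 := fun y hy => by
    simpa only [norm_iteratedFDeriv_zero] using FFCFE.norm_iteratedFDeriv_le_derivMax hf y₀ R 0 hy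
  have hD₁ : ∀ y ∈ Metric.closedBall y₀ R, ‖fderiv ℝ f y‖ ≤ FFCFE.derivMax f y₀ R 1 :=
    fun y hy => by
      simpa only [norm_iteratedFDeriv_one] using
        FFCFE.norm_iteratedFDeriv_le_derivMax hf y₀ R 1 hy
  obtain ⟨u, hu, husm⟩ := exists_contDiffOn_solvesIntegralEq hf hX hZ hR hM hD₀ hD₁ hε₃ hε₂ hε₁
  have huniq : ∀ h ∈ Icc (0 : ℝ) ε, ∀ v : ℝ → Fin d → ℝ,
      MapsTo v (Icc 0 1) (Metric.closedBall y₀ R) →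
      FFCFE.IsRKSolution φ t₀ f y₀ h v → EqOn v (u h) (Icc 0 1) := fun h hh v hvR hv =>
    SolvesIntegralEq.unique hf hZ hM hD₁ hε₃ hε₁ hh ((hRK h v).1 hv) (hu h hh).1 hvR (hu h hh).2
  refine ⟨u, fun h hh => ?_, husm⟩
  have hsol := (hRK h (u h)).2 (hu h hh).1
  exact ⟨(hu h hh).2, (hiff h _).2 hsol, hsol,
    fun v hvR hv => huniq h hh v hvR ((hiff h v).1 hv), huniq h hh⟩
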